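/- For $p>0$, $\nu\in\mathbb{C}$ and $|\arg x|<\pi/2$, $x\ne0$, let $$F_{p,\nu}(x)=\int_0^\infty t^{\nu-1}\exp\Bigl(-t^p-\frac{x}{t}\Bigr)\,dt .$$ Fix real $p>0$ and $a>0$, and put $X=p^{1/(p+1)}x^{p/(p+1)}$, $\nu=1+aX$, $\kappa=(p+1)/p$ and $\phi(\tau)=\tau^p/p+1/\tau-a\log\tau$ for $\tau>0$; all powers of complex numbers are principal values. Then the integral defining $F_{p,\nu}(x)$ converges absolutely. The equation $\tau^{p+1}=1+a\tau$ has exactly one positive root $\tau_s$, and $\tau_s>1$. Write $\phi_s''=\phi''(\tau_s)$, $\phi_s'''=\phi'''(\tau_s)$, and so on, and for $k\ge0$ let $$C_k=\frac{1}{(\phi_s'')^{k}}\sum_{j=0}^{2k}\frac{(-1)^j(k+\frac12)_j}{j!}\,[u^{2k}]\,g(u)^j,\qquad g(u)=\sum_{m\ge1}\frac{2\,\phi^{(m+2)}(\tau_s)}{(m+2)!\,\phi_s''}\,u^m,$$ where $(b)_j=b(b+1)\cdots(b+j-1)$ and $[u^{2k}]$ denotes the coefficient of $u^{2k}$. These are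 the coefficients obtained by inverting $\frac12w^2=\phi(\tau)-\phi(\tau_s)$: there is a real-analytic function $\tau(w)$ near $w=0$ with $\tau(0)=\tau_s$, $\tau'(0)>0$ and $\frac12w^2=\phi(\tau(w))-\phi(\tau_s)$, and for all small $w$ $$\frac{\tau'(w)+\tau'(-w)}{2}=\frac{1}{\sqrt{\phi_s''}}\sum_{k\ge0}C_kw^{2k}.$$ In particular $$C_0=1,\qquad C_1=\frac{5\phi_s'''^2-3\phi_s''\phi_s^{iv}}{24\phi_s''^3},$$ $$C_2=\frac{385\phi_s'''^4-630\phi_s''\phi_s'''^2\phi_s^{iv}+105\phi_s''^2(\phi_s^{iv})^2+168\phi_s''^2\phi_s'''\phi_s^{v}-24\phi_s''^3\phi_s^{vi}}{3456\phi_s''^6}.$$ Finally, as $|x|\to\infty$ in $|\arg x|<\pi/2$, $$F_{p,\nu}(x)\sim\sqrt{\frac{2\pi}{X\phi_s''}}\,\Bigl(\frac{x}{p}\Bigr)^{\nu/(p+1)}e^{-\kappa X/\tau_s-aX/p}\,\tau_s^{aX}\sum_{k\ge0}\frac{(\frac12)_kC_k}{(X/2)^k}$$ in the sense that, for every $N\ge0$,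 the left side minus the right side with the sum truncated to $k<N$ is $O(X^{-N})$ times the factor in front of the sum, uniformly in the sector, with a constant depending only on $p$, $a$ and $N$. -/

import Mathlib

open Filter Asymptotics MeasureTheory
open scoped Topology Nat

noncomputable section

/-- The integrand `t ^ (ν - 1) * exp (-t ^ p - x / t)` of Krätzel's integral. -/
def kratzelIntegrand (p : ℝ) (ν x : ℂ) (t : ℝ) : ℂ :=
  (t : ℂ) ^ (ν - 1) * Complex.exp (-((t ^ p : ℝ) : ℂ) - x / (t : ℂ))

/-- Krätzel's integral `F_{p,ν}(x) = ∫_0^∞ t ^ (ν - 1) exp (-t ^ p - x / t) dt`. -/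
def kratzelF (p : ℝ) (ν x : ℂ) : ℂ :=
  ∫ t in Set.Ioi (0 : ℝ), kratzelIntegrand p ν x t

/-- The large parameter `X = p ^ (1 / (p + 1)) * x ^ (p / (p + 1))` (principal branch). -/
def bigX (p : ℝ) (x : ℂ) : ℂ :=
  ((p ^ (1 / (p + 1)) : ℝ) : ℂ) * x ^ ((p / (p + 1) : ℝ) : ℂ)

/-- The order `ν = 1 + a X`. -/
def largeNu (p a : ℝ) (x : ℂ) : ℂ := 1 + (a : ℂ) * bigX p x

/-- The phase function `φ(τ) = τ ^ p / p + 1 / τ - a log τ`, for `τ > 0`. -/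
def phase (p a : ℝ) (τ : ℝ) : ℝ := τ ^ p / p + 1 / τ - a * Real.log τ

/-- The formal power series `∑_{m ≥ 1} 2 f^{(m+2)}(s) / ((m+2)! f''(s)) u ^ m`. At a critical
point `s` of `f` it is the Taylor series of `2 (f(s + u) - f(s)) / (f''(s) u ^ 2) - 1`. -/
def reducedPhaseSeries (f : ℝ → ℝ) (s : ℝ) : PowerSeries ℝ :=
  PowerSeries.mk fun m =>
    if m = 0 then 0 else 2 * iteratedDeriv (m + 2) f s / (((m + 2)! : ℝ) * iteratedDeriv 2 f s)

/-- The coefficient `C_k`, as an explicit finite combination of the derivatives of `f` at `s`: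
with `g` the series above, `C_k = f''(s) ^ (-k) ∑_{j ≤ 2k} (-1)^j (k + 1/2)_j / j! [u^{2k}] g^j`,
that is, `f''(s) ^ (-k)` times the coefficient of `u ^ (2k)` in `(1 + g) ^ (-k - 1/2)`. -/
def saddleCoeff (f : ℝ → ℝ) (s : ℝ) (k : ℕ) : ℝ :=
  (∑ j ∈ Finset.range (2 * k + 1),
      (-1 : ℝ) ^ j * (ascPochhammer ℝ j).eval ((k : ℝ) + 1 / 2) / (j ! : ℝ) *
        PowerSeries.coeff (2 * k) (reducedPhaseSeries f s ^ j)) /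
    iteratedDeriv 2 f s ^ k

/-- The factor `√(2π / (X φ''(s))) (x / p)^{ν/(p+1)} e^{-κ X / s - a X / p} s^{a X}` in front of
the expansion, with `κ = (p + 1) / p`, `ν = 1 + a X` and principal branches. -/
def expansionPrefactor (p a s : ℝ) (x : ℂ) : ℂ :=
  (2 * (Real.pi : ℂ) / (bigX p x * ((iteratedDeriv 2 (phase p a) s : ℝ) : ℂ))) ^ (1 / 2 : ℂ) *
    (x / (p : ℂ)) ^ (largeNu p a x / ((p : ℂ) + 1)) *
    Complex.exp (-((((p + 1) / p : ℝ) : ℂ) * bigX p x / (s : ℂ)) - (a : ℂ) * bigX p x / (p : ℂ)) *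
    (s : ℂ) ^ ((a : ℂ) * bigX p x)

/-- The filter `|x| → ∞` in the open sector `|arg x| < π / 2`. -/
def sectorAtInfinity : Filter ℂ :=
  Bornology.cobounded ℂ ⊓ 𝓟 {x : ℂ | |x.arg| < Real.pi / 2}

end

/-! For `x > 0`, the substitution `t = (x / p) ^ (1 / (p + 1)) * u` turns `t ^ p + x / t` into `X *
(u ^ p / p + 1 / u)`. With `ν` held fixed both sides of the resulting identity are holomorphic in
`x` on the right half-plane, so it extends there (`integral_twoTermIntegrand_rotation`); this takes
the place of rotating a contour. Only then is `ν = 1 + a X` inserted: `u ^ (ν - 1)` joins the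
exponential and leaves `∫ exp (-X φ(u)) du`, a Laplace integral with real phase and complex large
parameter (`kratzelF_eq`). Since `|arg X| < (π / 2) * p / (p + 1)`, one has `Re X ≥ c |X|` with a
fixed `c > 0`, which makes every estimate uniform in the sector.

The function `τ φ'(τ) = τ ^ p - 1 / τ - a` is strictly increasing, so `φ` decreases up to its only
critical point `s` and increases afterwards, with `φ''(s) > 0`. Away from `s` the integrand is
exponentially small. Near `s` the variable `w` with `w ^ 2 / 2 = φ(τ) - φ(s)` gives a Gaussian
integral of `τ'(w)`; odd powers of `w` cancel and even ones give the terms of the expansion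
(`AnalyticAt.gaussian_laplace`, `laplace_saddle`).

The coefficients come from Lagrange inversion (`exists_saddle_inverse`). With `u = τ - s` one has `w
= u h(u)` and `h ^ 2 = φ''(s) (1 + g)`, and the coefficient of `w ^ n` in `du/dw` is that of `u ^ n`
in `h ^ (-(n + 1))`. For `n = 2 k` this is a power `-(k + 1/2)` of `φ''(s) (1 + g)`, and the
binomial series yields `C_k / √φ''(s)`. -/

/-! ### Formal power series: Lagrange inversion and half-integer powers -/

namespace PowerSeries

/-- The residue computation behind Lagrange inversion: if `W = X * h` with `h` invertible, then
the coefficient of `X ^ n` in `W ^ m * W' * h ^ (-(n + 1))` is `1` if `m = n`, and `0` if `m < n`. -/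
theorem coeff_pow_mul_derivative_mul_inv_pow (h : PowerSeries ℝ) (h0 : constantCoeff h ≠ 0)
    {m n : ℕ} (hmn : m ≤ n) :
    coeff n ((X * h) ^ m * d⁄dX ℝ (X * h) * h⁻¹ ^ (n + 1)) = if m = n then 1 else 0 := by
  obtain ⟨j, rfl⟩ := Nat.exists_eq_add_of_le hmn
  have hh : h * h⁻¹ = 1 := PowerSeries.mul_inv_cancel h h0
  have h1 : h ^ m * h⁻¹ ^ m = 1 := by rw [← mul_pow, hh, one_pow]
  have key : (X * h) ^ m * d⁄dX ℝ (X * h) * h⁻¹ ^ (m + j + 1) =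
      X ^ m * (h⁻¹ ^ j + X * (d⁄dX ℝ h * h⁻¹ ^ (j + 1))) := by
    rw [Derivation.leibniz]
    simp only [derivative_X, smul_eq_mul, mul_one]
    calc (X * h) ^ m * (X * d⁄dX ℝ h + h) * h⁻¹ ^ (m + j + 1)
        = X ^ m * (h ^ m * h⁻¹ ^ m) * (h * h⁻¹ * h⁻¹ ^ j + X * (d⁄dX ℝ h * h⁻¹ ^ (j + 1))) := by
          ring
      _ = _ := by rw [h1, hh]; ring
  rw [key, coeff_X_pow_mul', if_pos (Nat.le_add_right m j), Nat.add_sub_cancel_left]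
  rcases j with _ | j
  · simp
  · rw [if_neg (by omega), map_add, coeff_succ_X_mul]
    -- Up to the factor `-(j + 1)` the second term is the derivative of the first, so comparing
    -- coefficients of `X ^ j` makes the two cancel: an exact derivative has no residue.
    have hd : d⁄dX ℝ (h⁻¹ ^ (j + 1)) = -(C ((j : ℝ) + 1) * (d⁄dX ℝ h * h⁻¹ ^ (j + 1 + 1))) := by
      rw [derivative_pow, derivative_inv']
      simp only [Nat.add_sub_cancel, map_add, map_one, map_natCast, Nat.cast_add, Nat.cast_one]
      ring
    have h2 := congrArg (coeff j) hd
    rw [coeff_derivative, map_neg, coeff_C_mul] at h2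
    have h3 : ((j : ℝ) + 1) ≠ 0 := by positivity
    have h4 : ((j : ℝ) + 1) * (coeff (j + 1) (h⁻¹ ^ (j + 1)) +
        coeff j (d⁄dX ℝ h * h⁻¹ ^ (j + 1 + 1))) = 0 := by linarith
    exact (mul_eq_zero.1 h4).resolve_left h3

theorem choose_neg_eq (r : ℝ) (j : ℕ) :
    Ring.choose (-r) j = (-1) ^ j * (ascPochhammer ℝ j).eval r / (j ! : ℝ) := by
  have h1 := Ring.descPochhammer_eq_factorial_smul_choose (-r) j
  have h2 := Polynomial.ascPochhammer_smeval_neg_eq_descPochhammer (-r) j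
  rw [neg_neg, Polynomial.ascPochhammer_smeval_eq_eval, h1] at h2
  have hj : (j ! : ℝ) ≠ 0 := by positivity
  rw [h2]
  simp only [Units.smul_def, nsmul_eq_mul, zsmul_eq_mul, Int.cast_negOnePow_natCast]
  have h3 : ((-1 : ℝ) ^ j) * (-1) ^ j = 1 := by rw [← mul_pow]; simp
  rw [← mul_assoc, h3]
  field_simp

theorem coeff_pow_eq_zero_of_lt {g : PowerSeries ℝ} (hg : constantCoeff g = 0) {n j : ℕ}
    (h : n < j) : coeff n (g ^ j) = 0 := by
  obtain ⟨q, rfl⟩ := X_dvd_iff.2 hg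
  rw [mul_pow, coeff_X_pow_mul', if_neg (by omega)]

/-- The coefficients of `(1 + g) ^ (-r)`. -/
theorem coeff_binomialSeries_neg_subst {g : PowerSeries ℝ} (hg : constantCoeff g = 0) (r : ℝ)
    (n : ℕ) :
    coeff n ((binomialSeries ℝ (-r)).subst g) = ∑ j ∈ Finset.range (n + 1),
      (-1 : ℝ) ^ j * (ascPochhammer ℝ j).eval r / (j ! : ℝ) * coeff n (g ^ j) := by
  rw [coeff_subst' (HasSubst.of_constantCoeff_zero' hg)]
  rw [finsum_eq_sum_of_support_subset (s := Finset.range (n + 1))]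
  · refine Finset.sum_congr rfl fun j _ => ?_
    rw [binomialSeries_coeff, choose_neg_eq]
    simp
  · intro j hj
    by_contra hj'
    refine hj ?_
    have : n < j := by simpa using hj'
    simp [coeff_pow_eq_zero_of_lt hg this]

theorem eq_of_sq_eq_sq {f g : PowerSeries ℝ} (hf : 0 < constantCoeff f)
    (hg : 0 < constantCoeff g) (h : f ^ 2 = g ^ 2) : f = g := by
  rcases sq_eq_sq_iff_eq_or_eq_neg.1 h with h | h
  · exact h
  · have := congrArg constantCoeff h
    rw [map_neg] at this
    linarith

/-- Odd powers of the inverse of a square root of `c * (1 + g)`. -/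
theorem coeff_inv_pow_of_sq_eq {g h : PowerSeries ℝ} {c : ℝ} (hc : 0 < c)
    (hg : constantCoeff g = 0) (h0 : constantCoeff h = Real.sqrt c)
    (hsq : h ^ 2 = C c * (1 + g)) (k n : ℕ) :
    coeff n (h⁻¹ ^ (2 * k + 1)) = 1 / Real.sqrt c * ((∑ j ∈ Finset.range (n + 1),
      (-1 : ℝ) ^ j * (ascPochhammer ℝ j).eval ((k : ℝ) + 1 / 2) / (j ! : ℝ) *
        coeff n (g ^ j)) / c ^ k) := by
  have hs : 0 < Real.sqrt c := Real.sqrt_pos.2 hc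
  have hss : Real.sqrt c * Real.sqrt c = c := Real.mul_self_sqrt hc.le
  have hsub := HasSubst.of_constantCoeff_zero' hg
  -- Two candidates for `(1 + g) ^ (-(k + 1/2))`, this binomial series and a normalised power of
  -- `h⁻¹`, both square to the inverse of `(1 + g) ^ (2 k + 1)`. Their constant terms are positive,
  -- so they agree.
  set B := (binomialSeries ℝ (-((k : ℝ) + 1 / 2))).subst g with hB
  have hB2 : B ^ 2 * (1 + g) ^ (2 * k + 1) = 1 := by
    have e : (1 + g) ^ (2 * k + 1) =
        (binomialSeries ℝ (((2 * k + 1 : ℕ) : ℝ))).subst g := by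
      rw [binomialSeries_nat, subst_pow hsub, subst_add hsub, subst_X hsub,
        ← coe_substAlgHom hsub, map_one]
    rw [e, hB, sq, ← subst_mul hsub, ← subst_mul hsub, ← binomialSeries_add, ← binomialSeries_add]
    have : -((k : ℝ) + 1 / 2) + -((k : ℝ) + 1 / 2) + ((2 * k + 1 : ℕ) : ℝ) = 0 := by
      push_cast; ring
    rw [this, binomialSeries_zero, ← coe_substAlgHom hsub, map_one]
  have hhinv : h * h⁻¹ = 1 := PowerSeries.mul_inv_cancel h (by rw [h0]; exact hs.ne')
  have hZ : (C (Real.sqrt c ^ (2 * k + 1)) * h⁻¹ ^ (2 * k + 1)) ^ 2 * (1 + g) ^ (2 * k + 1)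
      = 1 := by
    have e : C (Real.sqrt c ^ (2 * k + 1)) ^ 2 = C c ^ (2 * k + 1) := by
      rw [← map_pow, ← map_pow, ← pow_mul, mul_comm, pow_mul, sq, hss]
    calc _ = C (Real.sqrt c ^ (2 * k + 1)) ^ 2 * (1 + g) ^ (2 * k + 1) *
          (h⁻¹ ^ (2 * k + 1)) ^ 2 := by ring
      _ = (C c * (1 + g)) ^ (2 * k + 1) * (h⁻¹ ^ (2 * k + 1)) ^ 2 := by rw [e, ← mul_pow]
      _ = (h * h⁻¹) ^ (2 * (2 * k + 1)) := by rw [← hsq]; ring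
      _ = 1 := by rw [hhinv, one_pow]
  have hne : (1 + g) ^ (2 * k + 1) ≠ 0 := by
    intro h
    rw [h, mul_zero] at hB2
    exact zero_ne_one hB2
  have hB0 : constantCoeff B = 1 := by
    rw [← coeff_zero_eq_constantCoeff_apply, hB, coeff_binomialSeries_neg_subst hg]
    simp
  have hEq : C (Real.sqrt c ^ (2 * k + 1)) * h⁻¹ ^ (2 * k + 1) = B := by
    refine eq_of_sq_eq_sq ?_ (by rw [hB0]; exact one_pos)
      (mul_right_cancel₀ hne (hZ.trans hB2.symm))
    rw [map_mul, constantCoeff_C, map_pow, constantCoeff_inv, h0]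
    positivity
  have h5 := congrArg (coeff n) hEq
  rw [coeff_C_mul, hB, coeff_binomialSeries_neg_subst hg] at h5
  have e2 : Real.sqrt c ^ (2 * k + 1) = c ^ k * Real.sqrt c := by
    rw [pow_succ, pow_mul, sq, hss]
  rw [← h5, e2]
  field_simp

end PowerSeries

/-! ### The coefficients `C_k` for small `k` -/

theorem constantCoeff_reducedPhaseSeries (f : ℝ → ℝ) (s : ℝ) :
    PowerSeries.constantCoeff (reducedPhaseSeries f s) = 0 := by
  rw [← PowerSeries.coeff_zero_eq_constantCoeff_apply, reducedPhaseSeries, PowerSeries.coeff_mk,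
    if_pos rfl]

theorem saddleCoeff_zero (f : ℝ → ℝ) (s : ℝ) : saddleCoeff f s 0 = 1 := by
  simp [saddleCoeff]

theorem saddleCoeff_one (f : ℝ → ℝ) (s : ℝ) (h : iteratedDeriv 2 f s ≠ 0) :
    saddleCoeff f s 1 =
      (5 * iteratedDeriv 3 f s ^ 2 - 3 * iteratedDeriv 2 f s * iteratedDeriv 4 f s) /
        (24 * iteratedDeriv 2 f s ^ 3) := by
  have h20 : Finset.HasAntidiagonal.antidiagonal 2 = {(0, 2), (1, 1), (2, 0)} := rfl
  simp only [saddleCoeff, Finset.sum_range_succ, Finset.sum_range_zero, mul_one, pow_zero,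
    pow_succ, one_mul, PowerSeries.coeff_mul, h20]
  simp [reducedPhaseSeries, ascPochhammer_succ_right, Nat.factorial, PowerSeries.coeff_one]
  field_simp
  ring

theorem saddleCoeff_two (f : ℝ → ℝ) (s : ℝ) (h : iteratedDeriv 2 f s ≠ 0) :
    saddleCoeff f s 2 =
      (385 * iteratedDeriv 3 f s ^ 4
        - 630 * iteratedDeriv 2 f s * iteratedDeriv 3 f s ^ 2 * iteratedDeriv 4 f s
        + 105 * iteratedDeriv 2 f s ^ 2 * iteratedDeriv 4 f s ^ 2
        + 168 * iteratedDeriv 2 f s ^ 2 * iteratedDeriv 3 f s * iteratedDeriv 5 f s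
        - 24 * iteratedDeriv 2 f s ^ 3 * iteratedDeriv 6 f s) /
      (3456 * iteratedDeriv 2 f s ^ 6) := by
  have h10 : Finset.HasAntidiagonal.antidiagonal 1 = {(0, 1), (1, 0)} := rfl
  have h20 : Finset.HasAntidiagonal.antidiagonal 2 = {(0, 2), (1, 1), (2, 0)} := rfl
  have h30 : Finset.HasAntidiagonal.antidiagonal 3 = {(0, 3), (1, 2), (2, 1), (3, 0)} := rfl
  have h40 : Finset.HasAntidiagonal.antidiagonal 4 = {(0, 4), (1, 3), (2, 2), (3, 1), (4, 0)} := rfl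
  simp only [saddleCoeff, Finset.sum_range_succ, Finset.sum_range_zero, pow_zero,
    pow_succ, one_mul, PowerSeries.coeff_mul, h40, Nat.reduceMul]
  simp [reducedPhaseSeries, ascPochhammer_succ_right, Nat.factorial, PowerSeries.coeff_one,
    h10, h20, h30]
  field_simp
  ring

/-! ### Taylor series at the origin -/

noncomputable section

/-- The Taylor series of a real function at `0`, as a formal power series. -/
def taylorSeries (f : ℝ → ℝ) : PowerSeries ℝ :=
  PowerSeries.mk fun n => iteratedDeriv n f 0 / (n ! : ℝ)

theorem coeff_taylorSeries (f : ℝ → ℝ) (n : ℕ) :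
    PowerSeries.coeff n (taylorSeries f) = iteratedDeriv n f 0 / (n ! : ℝ) :=
  PowerSeries.coeff_mk _ _

theorem constantCoeff_taylorSeries (f : ℝ → ℝ) :
    PowerSeries.constantCoeff (taylorSeries f) = f 0 := by
  rw [← PowerSeries.coeff_zero_eq_constantCoeff_apply, coeff_taylorSeries]
  simp

theorem taylorSeries_congr {f g : ℝ → ℝ} (h : f =ᶠ[𝓝 0] g) : taylorSeries f = taylorSeries g := by
  ext n
  rw [coeff_taylorSeries, coeff_taylorSeries, h.iteratedDeriv_eq]

theorem taylorSeries_add {f g : ℝ → ℝ} (hf : AnalyticAt ℝ f 0) (hg : AnalyticAt ℝ g 0) :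
    taylorSeries (fun x => f x + g x) = taylorSeries f + taylorSeries g := by
  ext n
  rw [map_add, coeff_taylorSeries, coeff_taylorSeries, coeff_taylorSeries,
    iteratedDeriv_fun_add hf.contDiffAt hg.contDiffAt, add_div]

theorem taylorSeries_mul {f g : ℝ → ℝ} (hf : AnalyticAt ℝ f 0) (hg : AnalyticAt ℝ g 0) :
    taylorSeries (fun x => f x * g x) = taylorSeries f * taylorSeries g := by
  ext n
  rw [PowerSeries.coeff_mul, coeff_taylorSeries, iteratedDeriv_fun_mul hf.contDiffAt hg.contDiffAt,
    Finset.Nat.sum_antidiagonal_eq_sum_range_succ_mk, Finset.sum_div]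
  refine Finset.sum_congr rfl fun i hi => ?_
  have hin : i ≤ n := by simpa [Nat.lt_succ_iff] using hi
  rw [coeff_taylorSeries, coeff_taylorSeries, Nat.cast_choose ℝ hin]
  have h1 : (n ! : ℝ) ≠ 0 := by positivity
  have h2 : (i ! : ℝ) ≠ 0 := by positivity
  have h3 : ((n - i)! : ℝ) ≠ 0 := by positivity
  field_simp

theorem taylorSeries_const (c : ℝ) : taylorSeries (fun _ => c) = PowerSeries.C c := by
  ext n
  rw [coeff_taylorSeries, iteratedDeriv_const, PowerSeries.coeff_C]
  split_ifs with h <;> simp [h]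

theorem taylorSeries_pow {f : ℝ → ℝ} (hf : AnalyticAt ℝ f 0) (n : ℕ) :
    taylorSeries (fun x => f x ^ n) = taylorSeries f ^ n := by
  induction n with
  | zero => simpa using taylorSeries_const 1
  | succ n ih =>
    simp only [pow_succ]
    rw [taylorSeries_mul (hf.fun_pow n) hf, ih]

theorem taylorSeries_sum {ι : Type*} (t : Finset ι) {f : ι → ℝ → ℝ}
    (hf : ∀ i ∈ t, AnalyticAt ℝ (f i) 0) :
    taylorSeries (fun x => ∑ i ∈ t, f i x) = ∑ i ∈ t, taylorSeries (f i) := by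
  classical
  induction t using Finset.induction_on with
  | empty => simpa using taylorSeries_const 0
  | insert a t ha ih =>
    simp only [Finset.sum_insert ha]
    rw [taylorSeries_add (hf a (Finset.mem_insert_self a t))
      (Finset.analyticAt_fun_sum _ fun i hi => hf i (Finset.mem_insert_of_mem hi)),
      ih fun i hi => hf i (Finset.mem_insert_of_mem hi)]

theorem taylorSeries_deriv (f : ℝ → ℝ) :
    taylorSeries (deriv f) = PowerSeries.derivative ℝ (taylorSeries f) := by
  ext n
  rw [PowerSeries.coeff_derivative, coeff_taylorSeries, coeff_taylorSeries, iteratedDeriv_succ',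
    Nat.factorial_succ]
  push_cast
  have h1 : (n ! : ℝ) ≠ 0 := by positivity
  have h2 : (n : ℝ) + 1 ≠ 0 := by positivity
  field_simp

theorem taylorSeries_id : taylorSeries (fun x => x) = PowerSeries.X := by
  ext n
  rw [coeff_taylorSeries, PowerSeries.coeff_X]
  rcases n with _ | _ | n
  · simp
  · simp
  · rw [if_neg (by omega), iteratedDeriv_succ', iteratedDeriv_succ']
    simp

theorem AnalyticAt.dslope_self {f : ℝ → ℝ} {a : ℝ} (hf : AnalyticAt ℝ f a) :
    AnalyticAt ℝ (dslope f a) a := by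
  obtain ⟨p, hp⟩ := hf
  exact ⟨_, hp.has_fpower_series_dslope_fslope⟩

/-- Taylor's theorem with an analytic remainder. -/
theorem AnalyticAt.exists_eq_taylorSeries_sum_add {f : ℝ → ℝ} (hf : AnalyticAt ℝ f 0) (n : ℕ) :
    ∃ r : ℝ → ℝ, AnalyticAt ℝ r 0 ∧
      (∀ m, PowerSeries.coeff m (taylorSeries r) =
        PowerSeries.coeff (m + n) (taylorSeries f)) ∧
      ∀ x, f x = ∑ m ∈ Finset.range n, PowerSeries.coeff m (taylorSeries f) * x ^ m
        + x ^ n * r x := by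
  induction n with
  | zero => exact ⟨f, hf, by simp, by simp⟩
  | succ n ih =>
    obtain ⟨r, hr, hc, hfr⟩ := ih
    have h1 : ∀ x, r x = r 0 + x * dslope r 0 x := fun x => by
      have := sub_smul_dslope r 0 x
      rw [sub_zero, smul_eq_mul] at this
      linarith
    have h2 : taylorSeries r = PowerSeries.C (r 0) + PowerSeries.X * taylorSeries (dslope r 0) := by
      conv_lhs => rw [show r = fun x => r 0 + x * dslope r 0 x from funext h1]
      rw [taylorSeries_add (g := fun x => x * dslope r 0 x) analyticAt_const
        (analyticAt_id.fun_mul hr.dslope_self),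
        taylorSeries_const, taylorSeries_mul (f := fun x => x) analyticAt_id hr.dslope_self, taylorSeries_id]
    refine ⟨dslope r 0, hr.dslope_self, fun m => ?_, fun x => ?_⟩
    · rw [← add_assoc, add_right_comm, ← hc, h2, map_add, PowerSeries.coeff_succ_X_mul,
        PowerSeries.coeff_C, if_neg (by omega), zero_add]
    · have h3 : PowerSeries.coeff n (taylorSeries f) = r 0 := by
        rw [← zero_add n, ← hc, PowerSeries.coeff_zero_eq_constantCoeff_apply,
          constantCoeff_taylorSeries]
      rw [Finset.sum_range_succ, h3, hfr x, h1 x]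
      ring

theorem AnalyticAt.hasSum_taylorSeries {f : ℝ → ℝ} (hf : AnalyticAt ℝ f 0) :
    ∀ᶠ x in 𝓝 (0 : ℝ), HasSum (fun n => PowerSeries.coeff n (taylorSeries f) * x ^ n) (f x) := by
  have h := hf.hasFPowerSeriesAt.eventually_hasSum
  filter_upwards [h] with x hx
  simpa [coeff_taylorSeries, mul_comm, FormalMultilinearSeries.coeff_ofScalars] using hx

/-- Near a positive point the square root is `exp (log / 2)`. -/
theorem Real.analyticAt_sqrt_of_pos {x : ℝ} (hx : 0 < x) : AnalyticAt ℝ Real.sqrt x := by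
  have h : AnalyticAt ℝ (fun y => Real.exp (Real.log y / 2)) x :=
    ((analyticAt_log hx).div_const).rexp
  refine h.congr ?_
  filter_upwards [lt_mem_nhds hx] with y hy
  rw [Real.exp_half, Real.exp_log hy]

/-! ### Inversion of the phase at the saddle -/

/-- Lagrange inversion for a quadratic minimum: solving `w ^ 2 / 2 = f (T w) - f s`. -/
theorem exists_saddle_inverse {f : ℝ → ℝ} {s : ℝ} (hf : AnalyticAt ℝ f s) (h1 : deriv f s = 0)
    (h2 : 0 < iteratedDeriv 2 f s) :
    ∃ T : ℝ → ℝ, AnalyticAt ℝ T 0 ∧ T 0 = s ∧ 0 < deriv T 0 ∧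
      (∀ᶠ w in 𝓝 (0 : ℝ), w ^ 2 / 2 = f (T w) - f s) ∧
      ∀ k, PowerSeries.coeff (2 * k) (taylorSeries (deriv T)) =
        1 / Real.sqrt (iteratedDeriv 2 f s) * saddleCoeff f s k := by
  set c := iteratedDeriv 2 f s with hc
  have hsc : 0 < Real.sqrt c := Real.sqrt_pos.2 h2
  -- the shifted function, divided by `u ^ 2 / 2`
  have hF : AnalyticAt ℝ (fun u => f (s + u)) 0 := by
    refine AnalyticAt.fun_comp (g := f) ?_ (analyticAt_const.add analyticAt_id)
    simpa using hf
  have hFn : ∀ n, PowerSeries.coeff n (taylorSeries fun u => f (s + u)) =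
      iteratedDeriv n f s / (n ! : ℝ) := fun n => by
    rw [coeff_taylorSeries, iteratedDeriv_comp_const_add]
    simp
  obtain ⟨r, hr, hrc, hfr⟩ := hF.exists_eq_taylorSeries_sum_add 2
  have hfr' : ∀ u, f (s + u) - f s = u ^ 2 * r u := fun u => by
    have := hfr u
    simp only [Finset.sum_range_succ, Finset.sum_range_zero, hFn] at this
    rw [iteratedDeriv_one, h1] at this
    simp at this
    linarith
  have hr0 : r 0 = c / 2 := by
    rw [← constantCoeff_taylorSeries r, ← PowerSeries.coeff_zero_eq_constantCoeff_apply, hrc, hFn]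
    simp [hc]
  have hq : AnalyticAt ℝ (fun u => 2 * r u) 0 := analyticAt_const.fun_mul hr
  have hq0 : 2 * r 0 = c := by rw [hr0]; ring
  have hH : AnalyticAt ℝ (fun u => Real.sqrt (2 * r u)) 0 :=
    AnalyticAt.fun_comp (g := Real.sqrt) (Real.analyticAt_sqrt_of_pos (by rw [hq0]; exact h2)) hq
  have hpos : ∀ᶠ u in 𝓝 (0 : ℝ), 0 < 2 * r u :=
    hq.continuousAt.eventually (lt_mem_nhds (h2.trans_eq hq0.symm))
  set H : ℝ → ℝ := fun u => Real.sqrt (2 * r u) with hHdef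
  have hW : AnalyticAt ℝ (fun u => u * H u) 0 := analyticAt_id.fun_mul hH
  -- Near `0`, `W ^ 2 / 2 = f (s + u) - f s`, and `W' (0) = √c` is nonzero, so `T` can be taken as
  -- `s` plus the local inverse of `W`.
  set W : ℝ → ℝ := fun u => u * H u with hWdef
  have hH0 : H 0 = Real.sqrt c := by rw [hHdef]; simp only [hq0]
  have hdW : deriv W 0 = Real.sqrt c := by
    have := (hasDerivAt_id (0 : ℝ)).mul hH.differentiableAt.hasDerivAt
    rw [show W = id * H from rfl, this.deriv]
    simp [hH0]
  have hdW' : deriv W 0 ≠ 0 := by rw [hdW]; exact hsc.ne'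
  have hW0 : W 0 = 0 := by simp [hWdef]
  -- the Taylor series
  set h := taylorSeries H with hh
  have hh0 : PowerSeries.constantCoeff h = Real.sqrt c := by
    rw [hh, constantCoeff_taylorSeries, hH0]
  have hhsq : h ^ 2 = PowerSeries.C c * (1 + reducedPhaseSeries f s) := by
    rw [hh, ← taylorSeries_pow hH]
    have e : (fun x => H x ^ 2) =ᶠ[𝓝 0] fun u => 2 * r u := by
      filter_upwards [hpos] with u hu
      exact Real.sq_sqrt hu.le
    rw [taylorSeries_congr e, taylorSeries_mul analyticAt_const hr, taylorSeries_const]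
    ext m
    rw [PowerSeries.coeff_C_mul, PowerSeries.coeff_C_mul, hrc, hFn, map_add, PowerSeries.coeff_one,
      reducedPhaseSeries, PowerSeries.coeff_mk]
    rcases m with _ | m
    · simp [hc]
      ring
    · have : ((m + 1 + 2)! : ℝ) ≠ 0 := by positivity
      simp only [Nat.add_eq_zero_iff, one_ne_zero, and_false, if_false, zero_add, ← hc]
      field_simp
  have hWs : taylorSeries W = PowerSeries.X * h := by
    rw [hWdef, taylorSeries_mul (f := fun x => x) analyticAt_id hH, taylorSeries_id]
  -- the inverse
  set U := hW.hasStrictDerivAt.localInverse _ _ _ hdW' with hU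
  have hUa : AnalyticAt ℝ U 0 := by
    have := hW.analyticAt_localInverse hdW'
    rwa [hW0] at this
  have hUW : ∀ᶠ u in 𝓝 (0 : ℝ), U (W u) = u :=
    HasStrictFDerivAt.eventually_left_inverse ..
  have hWU : ∀ᶠ w in 𝓝 (0 : ℝ), W (U w) = w := by
    have : ∀ᶠ w in 𝓝 (W 0), W (U w) = w := HasStrictDerivAt.eventually_right_inverse ..
    rwa [hW0] at this
  have hU0 : U 0 = 0 := by
    have := hUW.self_of_nhds
    rwa [hW0] at this
  have hdT : deriv (fun w => s + U w) = deriv U := by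
    funext w
    rw [deriv_const_add]
  -- the chain rule
  have hchain : ∀ᶠ u in 𝓝 (0 : ℝ), deriv U (W u) * deriv W u = 1 := by
    have hWt : Tendsto W (𝓝 0) (𝓝 0) := by
      have := hW.continuousAt.tendsto
      rwa [hW0] at this
    filter_upwards [hUW.eventually_nhds, hWt.eventually hUa.eventually_analyticAt,
      hW.eventually_analyticAt] with u hu hu1 hu2
    have h3 := (hu1.differentiableAt.hasDerivAt.comp u hu2.differentiableAt.hasDerivAt)
    have h4 : (U ∘ W) =ᶠ[𝓝 u] id := hu
    exact (h4.hasDerivAt_iff.1 h3).unique (hasDerivAt_id u)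
  have hdU0 : deriv U 0 * Real.sqrt c = 1 := by
    have := hchain.self_of_nhds
    rwa [hW0, hdW] at this
  refine ⟨fun w => s + U w, analyticAt_const.fun_add hUa, by simp [hU0], ?_, ?_, fun k => ?_⟩
  · rw [hdT]
    exact pos_of_mul_pos_left (by rw [hdU0]; exact one_pos) hsc.le
  · have hUt : Tendsto U (𝓝 0) (𝓝 0) := by
      have := hUa.continuousAt.tendsto
      rwa [hU0] at this
    filter_upwards [hWU, hUt.eventually hpos] with w hw hw2
    rw [hfr', ← hw]
    simp only [hWdef, hHdef]
    simp only [hWdef, hHdef] at hw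
    rw [hw, ← hw, mul_pow, Real.sq_sqrt hw2.le, hw]
    ring
  · rw [hdT]
    -- Expand `U'` to order `2 k` with analytic remainder and insert this into `U'(W) W' = 1`. After
    -- multiplication by `h ^ (-(2 k + 1))`, the coefficient of `X ^ (2 k)` sees only the term `m =
    -- 2 k`: lower terms have zero residue, and the remainder is divisible by `X ^ (2 k + 1)`.
    obtain ⟨R, hR, -, hUR⟩ := hUa.deriv.exists_eq_taylorSeries_sum_add (2 * k + 1)
    have hRW : AnalyticAt ℝ (fun u => R (W u)) 0 :=
      AnalyticAt.fun_comp (g := R) (by rwa [hW0]) hW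
    have e1 : (fun u => ∑ m ∈ Finset.range (2 * k + 1),
        PowerSeries.coeff m (taylorSeries (deriv U)) * (W u ^ m * deriv W u) +
        W u ^ (2 * k + 1) * (R (W u) * deriv W u)) =ᶠ[𝓝 0] fun _ => 1 := by
      filter_upwards [hchain] with u hu
      rw [hUR, add_mul, Finset.sum_mul] at hu
      simpa only [mul_assoc] using hu
    have e2 := taylorSeries_congr e1
    have a1 : ∀ m, AnalyticAt ℝ (fun u => W u ^ m * deriv W u) 0 := fun m =>
      (hW.fun_pow m).fun_mul hW.deriv
    have a2 : ∀ m, AnalyticAt ℝ (fun u => PowerSeries.coeff m (taylorSeries (deriv U)) *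
        (W u ^ m * deriv W u)) 0 := fun m => analyticAt_const.fun_mul (a1 m)
    have a3 : AnalyticAt ℝ (fun u => R (W u) * deriv W u) 0 := hRW.fun_mul hW.deriv
    rw [taylorSeries_const, taylorSeries_add (Finset.analyticAt_fun_sum _ fun m _ => a2 m)
      ((hW.fun_pow _).fun_mul a3), taylorSeries_sum _ fun m _ => a2 m,
      taylorSeries_mul (hW.fun_pow _) a3, taylorSeries_pow hW, hWs] at e2
    have e3 := congrArg (fun P => PowerSeries.coeff (2 * k) (P * h⁻¹ ^ (2 * k + 1))) e2
    simp only [add_mul, map_add, Finset.sum_mul, map_sum, map_one, one_mul] at e3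
    have hh0' : PowerSeries.constantCoeff h ≠ 0 := by rw [hh0]; exact hsc.ne'
    rw [PowerSeries.coeff_inv_pow_of_sq_eq h2 (constantCoeff_reducedPhaseSeries f s) hh0 hhsq] at e3
    have e4 : PowerSeries.coeff (2 * k) ((PowerSeries.X * h) ^ (2 * k + 1) *
        taylorSeries (fun u => R (W u) * deriv W u) * h⁻¹ ^ (2 * k + 1)) = 0 := by
      rw [mul_pow, mul_assoc, mul_assoc, PowerSeries.coeff_X_pow_mul', if_neg (by omega)]
    rw [e4, add_zero] at e3
    rw [saddleCoeff, ← hc, ← e3]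
    have e5 : ∀ m ∈ Finset.range (2 * k + 1), PowerSeries.coeff (2 * k)
        (taylorSeries (fun u => PowerSeries.coeff m (taylorSeries (deriv U)) *
          (W u ^ m * deriv W u)) * h⁻¹ ^ (2 * k + 1)) =
        PowerSeries.coeff m (taylorSeries (deriv U)) * if m = 2 * k then 1 else 0 := by
      intro m hm
      rw [taylorSeries_mul analyticAt_const (a1 m), taylorSeries_const,
        taylorSeries_mul (hW.fun_pow m) hW.deriv, taylorSeries_pow hW, taylorSeries_deriv W, hWs,
        mul_assoc, PowerSeries.coeff_C_mul, PowerSeries.coeff_pow_mul_derivative_mul_inv_pow h hh0'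
          (by simpa [Nat.lt_succ_iff] using hm)]
    rw [Finset.sum_congr rfl e5]
    simp

/-- The even part of an analytic function is the sum of the even part of its Taylor series. -/
theorem AnalyticAt.hasSum_even_part {f : ℝ → ℝ} (hf : AnalyticAt ℝ f 0) :
    ∀ᶠ x in 𝓝 (0 : ℝ), HasSum (fun k : ℕ => PowerSeries.coeff (2 * k) (taylorSeries f) *
      x ^ (2 * k)) ((f x + f (-x)) / 2) := by
  have h := hf.hasSum_taylorSeries
  have hneg : Tendsto (fun x : ℝ => -x) (𝓝 0) (𝓝 0) := by
    simpa using (continuous_neg (G := ℝ)).tendsto 0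
  filter_upwards [h, hneg.eventually h] with x h1 h2
  have h3 := (h1.add h2).div_const 2
  have hinj : Function.Injective fun k : ℕ => 2 * k := fun a b hab => by
    simpa using hab
  rw [← hinj.hasSum_iff] at h3
  · refine h3.congr_fun fun k => ?_
    simp only [Function.comp_apply, (even_two_mul k).neg_pow]
    ring
  · intro n hn
    have : Odd n := by
      rw [← Nat.not_even_iff_odd]
      rintro ⟨k, rfl⟩
      exact hn ⟨k, by simp only; ring⟩
    rw [this.neg_pow]
    ring

end

/-! ### The saddle point and the shape of the phase -/

/-- Both terms increase. As `τ φ'(τ)` is this function minus `a`, the monotonicity gives uniqueness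
of the saddle and the sign of `φ'` on either side of it. -/
theorem strictMonoOn_rpow_sub_inv {p : ℝ} (hp : 0 < p) :
    StrictMonoOn (fun τ : ℝ => τ ^ p - 1 / τ) (Set.Ioi 0) := by
  intro x hx y hy hxy
  have h1 : x ^ p < y ^ p := Real.rpow_lt_rpow (le_of_lt hx) hxy hp
  have h2 : 1 / y < 1 / x := one_div_lt_one_div_of_lt hx hxy
  simp only
  linarith

theorem rpow_add_one_eq_iff {p a τ : ℝ} (hτ : 0 < τ) :
    τ ^ (p + 1) = 1 + a * τ ↔ τ ^ p - 1 / τ = a := by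
  rw [Real.rpow_add_one hτ.ne']
  constructor
  · intro h
    field_simp
    linarith
  · intro h
    field_simp at h
    linarith

theorem exists_saddle {p a : ℝ} (hp : 0 < p) (ha : 0 < a) :
    ∃ s : ℝ, 1 < s ∧ s ^ p - 1 / s = a := by
  have hcont : ContinuousOn (fun τ : ℝ => τ ^ p - 1 / τ) (Set.Ici 1) := by
    intro x hx
    have hx0 : x ≠ 0 := (zero_lt_one.trans_le hx).ne'
    exact ((Real.continuousAt_rpow_const x p (Or.inl hx0)).sub
      (continuousAt_const.div continuousAt_id hx0)).continuousWithinAt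
  have htop : Tendsto (fun τ : ℝ => τ ^ p - 1 / τ) atTop atTop := by
    refine tendsto_atTop_mono' _ ?_ (tendsto_atTop_add_const_right _ (-1) (tendsto_rpow_atTop hp))
    filter_upwards [eventually_ge_atTop 1] with τ hτ
    have : 1 / τ ≤ 1 := by rw [div_le_one (by linarith)]; exact hτ
    linarith
  obtain ⟨M, hM1, hM⟩ := ((eventually_ge_atTop (1 : ℝ)).and
    (htop.eventually_ge_atTop a)).exists
  have h1 : (fun τ : ℝ => τ ^ p - 1 / τ) 1 ≤ a := by
    simpa using ha.le
  obtain ⟨s, hs, hsa⟩ := intermediate_value_Icc hM1 (hcont.mono Set.Icc_subset_Ici_self) ⟨h1, hM⟩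
  refine ⟨s, lt_of_le_of_ne hs.1 ?_, hsa⟩
  rintro rfl
  simp at hsa
  exact ha.ne hsa

theorem hasDerivAt_phase {p a τ : ℝ} (hp : 0 < p) (hτ : 0 < τ) :
    HasDerivAt (phase p a) ((τ ^ p - 1 / τ - a) / τ) τ := by
  have h1 := (Real.hasDerivAt_rpow_const (p := p) (Or.inl hτ.ne')).div_const p
  have h2 := hasDerivAt_inv hτ.ne'
  have h3 := (Real.hasDerivAt_log hτ.ne').const_mul a
  have h4 := (h1.add h2).sub h3
  have e : phase p a = ((fun x => x ^ p / p) + fun y => y⁻¹) - fun y => a * Real.log y := by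
    funext x
    simp [phase]
  rw [e]
  refine h4.congr_deriv ?_
  rw [Real.rpow_sub_one hτ.ne']
  field_simp
  ring

theorem analyticAt_phase (p a : ℝ) {τ : ℝ} (hτ : 0 < τ) : AnalyticAt ℝ (phase p a) τ := by
  have h1 : AnalyticAt ℝ (fun x : ℝ => Real.exp (Real.log x * p)) τ :=
    ((analyticAt_log hτ).fun_mul analyticAt_const).rexp
  have h2 : AnalyticAt ℝ (fun x : ℝ => Real.exp (Real.log x * p) / p + 1 / x - a * Real.log x) τ :=
    (h1.div_const.fun_add (analyticAt_const.fun_div analyticAt_id hτ.ne')).fun_sub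
      (analyticAt_const.fun_mul (analyticAt_log hτ))
  refine h2.congr ?_
  filter_upwards [lt_mem_nhds hτ] with x hx
  rw [phase, Real.rpow_def_of_pos hx]

theorem deriv_phase_saddle {p a s : ℝ} (hp : 0 < p) (hs : 0 < s) (hsa : s ^ p - 1 / s = a) :
    deriv (phase p a) s = 0 := by
  rw [(hasDerivAt_phase hp hs).deriv, hsa, sub_self, zero_div]

/-- Write `φ' = ψ / τ` with `ψ = τ ^ p - 1 / τ - a`. As `ψ` vanishes at `s`, `φ''(s) = ψ'(s) / s`,
and both terms of `ψ'` are positive. -/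
theorem iteratedDeriv_two_phase_saddle_pos {p a s : ℝ} (hp : 0 < p) (hs : 0 < s)
    (hsa : s ^ p - 1 / s = a) : 0 < iteratedDeriv 2 (phase p a) s := by
  have e : deriv (phase p a) =ᶠ[𝓝 s] fun τ => (τ ^ p - τ⁻¹ - a) / τ := by
    filter_upwards [lt_mem_nhds hs] with τ hτ
    rw [(hasDerivAt_phase hp hτ).deriv, one_div]
  have h1 := ((Real.hasDerivAt_rpow_const (p := p) (Or.inl hs.ne')).sub
    (hasDerivAt_inv hs.ne')).sub_const a
  have h2 := h1.fun_div (hasDerivAt_id s) hs.ne'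
  rw [iteratedDeriv_succ, iteratedDeriv_one, e.deriv_eq]
  have h3 : deriv (fun τ : ℝ => (τ ^ p - τ⁻¹ - a) / τ) s = _ := h2.deriv
  rw [h3]
  have h4 : s ^ p - s⁻¹ - a = 0 := by rw [← hsa, one_div, sub_self]
  simp only [Pi.sub_apply, id, h4]
  have h5 : 0 < s ^ (p - 1) := Real.rpow_pos_of_pos hs _
  have h6 : 0 < (s ^ 2)⁻¹ := by positivity
  rw [zero_mul, sub_zero, sub_neg_eq_add]
  positivity

theorem strictAntiOn_phase {p a s : ℝ} (hp : 0 < p) (hsa : s ^ p - 1 / s = a) :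
    StrictAntiOn (phase p a) (Set.Ioc 0 s) := by
  refine strictAntiOn_of_deriv_neg (convex_Ioc 0 s)
    (fun x hx => (hasDerivAt_phase hp hx.1).continuousAt.continuousWithinAt) fun x hx => ?_
  rw [interior_Ioc] at hx
  rw [(hasDerivAt_phase hp hx.1).deriv]
  have := strictMonoOn_rpow_sub_inv hp hx.1 (hx.1.trans hx.2) hx.2
  simp only [hsa] at this
  exact div_neg_of_neg_of_pos (by linarith) hx.1

theorem strictMonoOn_phase {p a s : ℝ} (hp : 0 < p) (hs : 0 < s) (hsa : s ^ p - 1 / s = a) :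
    StrictMonoOn (phase p a) (Set.Ici s) := by
  refine strictMonoOn_of_deriv_pos (convex_Ici s)
    (fun x hx => (hasDerivAt_phase hp (hs.trans_le hx)).continuousAt.continuousWithinAt)
      fun x hx => ?_
  rw [interior_Ici] at hx
  have hx0 : 0 < x := hs.trans hx
  rw [(hasDerivAt_phase hp hx0).deriv]
  have := strictMonoOn_rpow_sub_inv hp hs hx0 hx
  simp only [hsa] at this
  exact div_pos (by linarith) hx0

/-! ### Gaussian moments with complex parameter -/

theorem integrable_pow_mul_cexp_neg_mul_sq {b : ℂ} (hb : 0 < b.re) (n : ℕ) :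
    Integrable fun w : ℝ => (w : ℂ) ^ n * Complex.exp (-b * (w : ℂ) ^ 2) := by
  have h := integrable_rpow_mul_exp_neg_mul_sq hb (s := n) (by
    have : (0 : ℝ) ≤ n := Nat.cast_nonneg n
    linarith)
  refine (integrable_norm_iff ?_).1 (h.norm.congr ?_)
  · exact (by fun_prop : Continuous fun w : ℝ =>
      (w : ℂ) ^ n * Complex.exp (-b * (w : ℂ) ^ 2)).aestronglyMeasurable
  · refine Eventually.of_forall fun w => ?_
    simp only [Real.rpow_natCast, norm_mul, norm_pow, Complex.norm_exp, Complex.norm_real,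
      Real.norm_eq_abs, Real.abs_exp]
    congr 2
    rw [← Complex.ofReal_pow, Complex.re_mul_ofReal, Complex.neg_re]

theorem integral_odd_pow_mul_cexp_neg_mul_sq (b : ℂ) (k : ℕ) :
    ∫ w : ℝ, (w : ℂ) ^ (2 * k + 1) * Complex.exp (-b * (w : ℂ) ^ 2) = 0 := by
  have h := MeasureTheory.integral_neg_eq_self
    (fun w : ℝ => (w : ℂ) ^ (2 * k + 1) * Complex.exp (-b * (w : ℂ) ^ 2)) volume
  have e : (fun w : ℝ => (((-w : ℝ)) : ℂ) ^ (2 * k + 1) *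
      Complex.exp (-b * ((-w : ℝ) : ℂ) ^ 2)) =
      fun w : ℝ => -((w : ℂ) ^ (2 * k + 1) * Complex.exp (-b * (w : ℂ) ^ 2)) := by
    funext w
    push_cast
    rw [(odd_two_mul_add_one k).neg_pow, neg_sq]
    ring
  rw [e, integral_neg] at h
  exact self_eq_neg.1 h.symm

/-- Integrating `w ^ (2 k + 1)` against the derivative of `exp (-b w ^ 2)` by parts gives `2 b
M_{k+1} = (2 k + 1) M_k` for the moments, starting from the Gaussian integral. -/
theorem integral_even_pow_mul_cexp_neg_mul_sq {b : ℂ} (hb : 0 < b.re) (k : ℕ) :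
    ∫ w : ℝ, (w : ℂ) ^ (2 * k) * Complex.exp (-b * (w : ℂ) ^ 2) =
      (ascPochhammer ℂ k).eval (1 / 2 : ℂ) * b ^ (-(k : ℤ)) * (Real.pi / b) ^ (1 / 2 : ℂ) := by
  have hb0 : b ≠ 0 := by
    rintro rfl
    simp at hb
  induction k with
  | zero => simpa using integral_gaussian_complex hb
  | succ k ih =>
    have hu : ∀ w : ℝ, HasDerivAt (fun w : ℝ => (w : ℂ) ^ (2 * k + 1))
        (((2 * k + 1 : ℕ) : ℂ) * (w : ℂ) ^ (2 * k)) w := fun w => by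
      simpa using (hasDerivAt_pow (2 * k + 1) (w : ℂ)).comp_ofReal
    have hv : ∀ w : ℝ, HasDerivAt (fun w : ℝ => Complex.exp (-b * (w : ℂ) ^ 2))
        (-2 * b * w * Complex.exp (-b * (w : ℂ) ^ 2)) w := fun w => by
      have := (((hasDerivAt_pow 2 (w : ℂ)).const_mul (-b)).cexp).comp_ofReal
      convert this using 1
      simp
      ring
    have h := integral_mul_deriv_eq_deriv_mul_of_integrable (fun w _ => hu w) (fun w _ => hv w)
      (by
        have := (integrable_pow_mul_cexp_neg_mul_sq hb (2 * (k + 1))).const_mul (-2 * b)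
        refine this.congr (Eventually.of_forall fun w => ?_)
        simp only [Pi.mul_apply]
        ring)
      (by
        have := (integrable_pow_mul_cexp_neg_mul_sq hb (2 * k)).const_mul ((2 * k + 1 : ℕ) : ℂ)
        refine this.congr (Eventually.of_forall fun w => ?_)
        simp only [Pi.mul_apply]
        ring)
      (integrable_pow_mul_cexp_neg_mul_sq hb (2 * k + 1))
    have e1 : ∀ w : ℝ, (w : ℂ) ^ (2 * k + 1) * (-2 * b * w * Complex.exp (-b * (w : ℂ) ^ 2)) =
        -2 * b * ((w : ℂ) ^ (2 * (k + 1)) * Complex.exp (-b * (w : ℂ) ^ 2)) := fun w => by ring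
    simp only [e1, mul_assoc ((2 * k + 1 : ℕ) : ℂ), integral_const_mul] at h
    rw [ih] at h
    have e2 : b ^ (-((k + 1 : ℕ) : ℤ)) = b ^ (-(k : ℤ)) * b⁻¹ := by
      push_cast
      rw [neg_add, zpow_add₀ hb0, zpow_neg_one]
    rw [ascPochhammer_succ_right, e2]
    simp only [Polynomial.eval_mul, Polynomial.eval_add, Polynomial.eval_X,
      Polynomial.eval_natCast]
    refine mul_left_cancel₀ (mul_ne_zero (by norm_num : (-2 : ℂ) ≠ 0) hb0) (h.trans ?_)
    push_cast
    field_simp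
    ring

theorem integral_even_pow_mul_exp_neg_mul_sq {b : ℝ} (hb : 0 < b) (k : ℕ) :
    ∫ w : ℝ, w ^ (2 * k) * Real.exp (-b * w ^ 2) =
      (ascPochhammer ℝ k).eval (1 / 2 : ℝ) * Real.sqrt Real.pi * b ^ (-((k : ℝ) + 1 / 2)) := by
  have h := integral_even_pow_mul_cexp_neg_mul_sq (b := b) (by simpa using hb) k
  have e : (fun w : ℝ => (w : ℂ) ^ (2 * k) * Complex.exp (-(b : ℂ) * (w : ℂ) ^ 2)) =
      fun w : ℝ => ((w ^ (2 * k) * Real.exp (-b * w ^ 2) : ℝ) : ℂ) := by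
    funext w
    push_cast
    rfl
  rw [e, integral_complex_ofReal] at h
  have e2 : (Real.pi / b : ℂ) ^ (1 / 2 : ℂ) = ((Real.sqrt Real.pi * b ^ (-(1 / 2) : ℝ) : ℝ) : ℂ) := by
    rw [Real.rpow_neg hb.le, ← Real.sqrt_eq_rpow, ← div_eq_mul_inv, ← Real.sqrt_div Real.pi_pos.le,
      Real.sqrt_eq_rpow, Complex.ofReal_cpow (by positivity)]
    push_cast
    rfl
  have e3 : (ascPochhammer ℂ k).eval (1 / 2 : ℂ) = (((ascPochhammer ℝ k).eval (1 / 2 : ℝ) : ℝ) : ℂ) := by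
    rw [← ascPochhammer_map (algebraMap ℝ ℂ), Polynomial.eval_map_algebraMap]
    have := Polynomial.aeval_algebraMap_apply ℂ (1 / 2 : ℝ) (ascPochhammer ℝ k)
    simpa using this
  rw [e2, e3] at h
  have h' := h.trans (b := _) (c := (((ascPochhammer ℝ k).eval (1 / 2 : ℝ) * Real.sqrt Real.pi *
    b ^ (-((k : ℝ) + 1 / 2)) : ℝ) : ℂ)) (by
    rw [neg_add, Real.rpow_add hb, Real.rpow_neg hb.le (k : ℝ), Real.rpow_natCast]
    push_cast
    rw [zpow_neg, zpow_natCast]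
    ring)
  exact_mod_cast h'

/-! ### Watson's lemma and Laplace's method -/

/-- A truncation of an analytic function differs from its Taylor polynomial of degree `n - 1` by
`O(|w| ^ n)`, globally. -/
theorem AnalyticAt.exists_indicator_sub_taylor_le {g : ℝ → ℝ} (hg : AnalyticAt ℝ g 0) (n : ℕ) :
    ∀ᶠ ε in 𝓝[>] (0 : ℝ), ∃ K : ℝ, ∀ w : ℝ, |(Set.Ioc (-ε) ε).indicator g w -
      ∑ m ∈ Finset.range n, PowerSeries.coeff m (taylorSeries g) * w ^ m| ≤ K * |w| ^ n := by
  obtain ⟨r, hr, -, hgr⟩ := hg.exists_eq_taylorSeries_sum_add n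
  have hb : ∀ᶠ w in 𝓝 (0 : ℝ), |r w| < |r 0| + 1 :=
    hr.continuousAt.abs.eventually (gt_mem_nhds (lt_add_one |r 0|))
  obtain ⟨ρ, hρ, hball⟩ := Metric.eventually_nhds_iff.1 hb
  filter_upwards [Ioo_mem_nhdsGT hρ] with ε hε
  have hε0 : 0 < ε := hε.1
  -- Outside the window `|w| ≥ ε`, so `|w| ^ m ≤ |w| ^ n / ε ^ (n - m)`, and the Taylor polynomial
  -- alone is at most `S |w| ^ n`.
  set S := ∑ m ∈ Finset.range n, |PowerSeries.coeff m (taylorSeries g)| / ε ^ (n - m) with hS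
  have hS0 : 0 ≤ S := Finset.sum_nonneg fun m _ => by positivity
  refine ⟨|r 0| + 1 + S, fun w => ?_⟩
  by_cases hw : w ∈ Set.Ioc (-ε) ε
  · rw [Set.indicator_of_mem hw, hgr w, add_sub_cancel_left, abs_mul, abs_pow, mul_comm]
    have h1 : |r w| < |r 0| + 1 := by
      refine hball ?_
      rw [Real.dist_eq, sub_zero]
      exact (abs_le.2 ⟨hw.1.le, hw.2⟩).trans_lt hε.2
    gcongr
    linarith
  · rw [Set.indicator_of_notMem hw, zero_sub, abs_neg]
    have hw' : ε ≤ |w| := by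
      by_contra h
      rw [not_le, abs_lt] at h
      exact hw ⟨h.1, h.2.le⟩
    refine (Finset.abs_sum_le_sum_abs _ _).trans ?_
    have h2 : ∑ m ∈ Finset.range n, |PowerSeries.coeff m (taylorSeries g) * w ^ m| ≤
        S * |w| ^ n := by
      rw [hS, Finset.sum_mul]
      refine Finset.sum_le_sum fun m hm => ?_
      have hmn : m ≤ n := (Finset.mem_range.1 hm).le
      rw [abs_mul, abs_pow, div_mul_eq_mul_div, le_div_iff₀ (by positivity), mul_assoc]
      refine mul_le_mul_of_nonneg_left ?_ (abs_nonneg _)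
      calc |w| ^ m * ε ^ (n - m) ≤ |w| ^ m * |w| ^ (n - m) := by gcongr
        _ = |w| ^ n := by rw [← pow_add, Nat.add_sub_cancel' hmn]
    refine h2.trans ?_
    gcongr
    have := abs_nonneg (r 0)
    linarith

theorem sum_range_two_mul {M : Type*} [AddCommMonoid M] (g : ℕ → M) (n : ℕ) :
    ∑ m ∈ Finset.range (2 * n), g m = ∑ k ∈ Finset.range n, (g (2 * k) + g (2 * k + 1)) := by
  induction n with
  | zero => simp
  | succ n ih =>
    rw [Nat.mul_succ, Finset.sum_range_succ, Finset.sum_range_succ, ih, Finset.sum_range_succ,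
      add_assoc]

/-- Watson's lemma for a Gaussian weight, with a complex large parameter. -/
theorem AnalyticAt.gaussian_laplace {g : ℝ → ℝ} (hg : AnalyticAt ℝ g 0) (N : ℕ) {c : ℝ}
    (hc : 0 < c) : ∀ᶠ ε in 𝓝[>] (0 : ℝ), ContinuousOn g (Set.Icc (-ε) ε) → ∃ C : ℝ, ∀ X : ℂ,
      0 < ‖X‖ → c * ‖X‖ ≤ X.re →
      ‖(∫ w in (-ε)..ε, (g w : ℂ) * Complex.exp (-(X / 2) * (w : ℂ) ^ 2)) -
        ∑ k ∈ Finset.range N, ((PowerSeries.coeff (2 * k) (taylorSeries g) : ℝ) : ℂ) *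
          ((ascPochhammer ℂ k).eval (1 / 2 : ℂ) * (X / 2) ^ (-(k : ℤ)) *
            (2 * Real.pi / X) ^ (1 / 2 : ℂ))‖ ≤ C * ‖X‖ ^ (-((N : ℝ) + 1 / 2)) := by
  filter_upwards [hg.exists_indicator_sub_taylor_le (2 * N), self_mem_nhdsWithin] with ε hK hε hcont
  obtain ⟨K, hK⟩ := hK
  have hε : 0 < ε := hε
  set A := (ascPochhammer ℝ N).eval (1 / 2 : ℝ) * Real.sqrt Real.pi with hA
  have hK0 : 0 ≤ K := by
    have := (abs_nonneg _).trans (hK 1)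
    simpa using this
  have hA0 : 0 ≤ A := mul_nonneg (ascPochhammer_pos N _ (by norm_num)).le (Real.sqrt_nonneg _)
  -- The error `K |w| ^ (2 N)` is integrated against a Gaussian with parameter `Re (X / 2) ≥ (c / 2)
  -- |X|`; its moment supplies this constant.
  refine ⟨K * (A * (c / 2) ^ (-((N : ℝ) + 1 / 2))), fun X hX hcX => ?_⟩
  have hX0 : X ≠ 0 := norm_pos_iff.1 hX
  have hXre : 0 < X.re := lt_of_lt_of_le (by positivity) hcX
  set b := X / 2 with hb
  have hbre : b.re = X.re / 2 := by rw [hb]; simp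
  have hb0 : 0 < b.re := by rw [hbre]; positivity
  set P : ℝ → ℝ := fun w => ∑ m ∈ Finset.range (2 * N),
    PowerSeries.coeff m (taylorSeries g) * w ^ m with hP
  set G : ℝ → ℝ := (Set.Ioc (-ε) ε).indicator g with hG
  have hle : -ε ≤ ε := by linarith
  -- the integral of the Taylor polynomial
  have hPint : ∀ m, Integrable fun w : ℝ => ((PowerSeries.coeff m (taylorSeries g) : ℝ) : ℂ) *
      ((w : ℂ) ^ m * Complex.exp (-b * (w : ℂ) ^ 2)) := fun m =>
    (integrable_pow_mul_cexp_neg_mul_sq hb0 m).const_mul _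
  have hPe : ∀ w : ℝ, (P w : ℂ) * Complex.exp (-b * (w : ℂ) ^ 2) = ∑ m ∈ Finset.range (2 * N),
      ((PowerSeries.coeff m (taylorSeries g) : ℝ) : ℂ) *
        ((w : ℂ) ^ m * Complex.exp (-b * (w : ℂ) ^ 2)) := fun w => by
    simp only [hP]
    push_cast
    rw [Finset.sum_mul]
    exact Finset.sum_congr rfl fun m _ => by ring
  have hPi : Integrable fun w : ℝ => (P w : ℂ) * Complex.exp (-b * (w : ℂ) ^ 2) := by
    simp only [hPe]
    exact integrable_finsetSum _ fun m _ => hPint m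
  have hPv : ∫ w : ℝ, (P w : ℂ) * Complex.exp (-b * (w : ℂ) ^ 2) =
      ∑ k ∈ Finset.range N, ((PowerSeries.coeff (2 * k) (taylorSeries g) : ℝ) : ℂ) *
          ((ascPochhammer ℂ k).eval (1 / 2 : ℂ) * b ^ (-(k : ℤ)) *
            (2 * Real.pi / X) ^ (1 / 2 : ℂ)) := by
    simp only [hPe]
    rw [integral_finsetSum _ fun m _ => hPint m, sum_range_two_mul]
    refine Finset.sum_congr rfl fun k _ => ?_
    rw [integral_const_mul, integral_const_mul, integral_odd_pow_mul_cexp_neg_mul_sq,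
      integral_even_pow_mul_cexp_neg_mul_sq hb0, mul_zero, add_zero]
    have : (Real.pi : ℂ) / b = 2 * Real.pi / X := by
      rw [hb]
      field_simp
    rw [this]
  -- the truncated integral
  have hGe : (fun w : ℝ => (G w : ℂ) * Complex.exp (-b * (w : ℂ) ^ 2)) =
      (Set.Ioc (-ε) ε).indicator fun w : ℝ => (g w : ℂ) * Complex.exp (-b * (w : ℂ) ^ 2) := by
    funext w
    by_cases hw : w ∈ Set.Ioc (-ε) ε <;> simp [hG, hw]
  have hGon : IntegrableOn (fun w : ℝ => (g w : ℂ) * Complex.exp (-b * (w : ℂ) ^ 2))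
      (Set.Ioc (-ε) ε) := by
    refine (ContinuousOn.integrableOn_Icc ?_).mono_set Set.Ioc_subset_Icc_self
    refine (Complex.continuous_ofReal.comp_continuousOn hcont).mul (Continuous.continuousOn ?_)
    fun_prop
  have hGi : Integrable fun w : ℝ => (G w : ℂ) * Complex.exp (-b * (w : ℂ) ^ 2) := by
    rw [hGe]
    exact hGon.integrable_indicator measurableSet_Ioc
  have hGv : ∫ w : ℝ, (G w : ℂ) * Complex.exp (-b * (w : ℂ) ^ 2) =
      ∫ w in (-ε)..ε, (g w : ℂ) * Complex.exp (-b * (w : ℂ) ^ 2) := by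
    rw [hGe, integral_indicator measurableSet_Ioc, intervalIntegral.integral_of_le hle]
  rw [← hPv, ← hGv, ← integral_sub hGi hPi]
  have hbound : ∀ w : ℝ, ‖(G w : ℂ) * Complex.exp (-b * (w : ℂ) ^ 2) -
      (P w : ℂ) * Complex.exp (-b * (w : ℂ) ^ 2)‖ ≤
      K * (w ^ (2 * N) * Real.exp (-b.re * w ^ 2)) := fun w => by
    rw [← sub_mul, ← Complex.ofReal_sub, norm_mul, Complex.norm_real, Complex.norm_exp,
      ← Complex.ofReal_pow, Complex.re_mul_ofReal, Complex.neg_re, ← mul_assoc]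
    refine mul_le_mul_of_nonneg_right ?_ (Real.exp_pos _).le
    have := hK w
    rwa [pow_mul |w|, sq_abs, ← pow_mul] at this
  have hdom : Integrable fun w : ℝ => K * (w ^ (2 * N) * Real.exp (-b.re * w ^ 2)) := by
    have := integrable_rpow_mul_exp_neg_mul_sq hb0 (s := ((2 * N : ℕ) : ℝ)) (by
      have : (0 : ℝ) ≤ ((2 * N : ℕ) : ℝ) := Nat.cast_nonneg _
      linarith)
    simp only [Real.rpow_natCast] at this
    exact this.const_mul K
  refine (norm_integral_le_of_norm_le hdom (Eventually.of_forall hbound)).trans ?_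
  rw [integral_const_mul, integral_even_pow_mul_exp_neg_mul_sq hb0, ← hA, mul_assoc K, mul_assoc A]
  refine mul_le_mul_of_nonneg_left ?_ hK0
  refine mul_le_mul_of_nonneg_left ?_ hA0
  rw [← Real.mul_rpow (by positivity) hX.le]
  refine Real.rpow_le_rpow_of_nonpos (by positivity) ?_ (by
    have : (0 : ℝ) ≤ N := Nat.cast_nonneg N
    linarith)
  rw [hbre]
  linarith

/-- Laplace's method at an interior minimum of the phase, with a complex large parameter, to all
orders, in terms of the solution `T` of `w ^ 2 / 2 = f (T w) - f s`. -/
theorem laplace_saddle {f T : ℝ → ℝ} {s : ℝ} (hs : 0 < s) (hcont : ContinuousOn f (Set.Ioi 0))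
    (hanti : StrictAntiOn f (Set.Ioc 0 s)) (hmono : StrictMonoOn f (Set.Ici s))
    (hint : IntegrableOn (fun t => Real.exp (-f t)) (Set.Ioi 0))
    (hT : AnalyticAt ℝ T 0) (hT0 : T 0 = s) (hT' : 0 < deriv T 0)
    (hTw : ∀ᶠ w in 𝓝 (0 : ℝ), w ^ 2 / 2 = f (T w) - f s) (N : ℕ) {c : ℝ} (hc : 0 < c) :
    ∃ C R : ℝ, ∀ X : ℂ, R ≤ ‖X‖ → c * ‖X‖ ≤ X.re →
      ‖(∫ t in Set.Ioi (0 : ℝ), Complex.exp (-X * ((f t - f s : ℝ) : ℂ))) -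
        ∑ k ∈ Finset.range N, ((PowerSeries.coeff (2 * k) (taylorSeries (deriv T)) : ℝ) : ℂ) *
          ((ascPochhammer ℂ k).eval (1 / 2 : ℂ) * (X / 2) ^ (-(k : ℤ)) *
            (2 * Real.pi / X) ^ (1 / 2 : ℂ))‖ ≤ C * ‖X‖ ^ (-((N : ℝ) + 1 / 2)) := by
  have hTpos : ∀ᶠ w in 𝓝 (0 : ℝ), 0 < T w :=
    hT.continuousAt.eventually (lt_mem_nhds (by rwa [hT0]))
  have hTd : ∀ᶠ w in 𝓝 (0 : ℝ), 0 < deriv T w := hT.deriv.continuousAt.eventually (lt_mem_nhds hT')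
  have hTa := hT.eventually_analyticAt
  obtain ⟨ρ, hρ, hball⟩ := Metric.eventually_nhds_iff.1 (((hTpos.and hTd).and hTa).and hTw)
  obtain ⟨ε, hεC, hε⟩ := ((hT.deriv.gaussian_laplace N hc).and (Ioo_mem_nhdsGT hρ)).exists
  have hε0 : 0 < ε := hε.1
  have hle : -ε ≤ ε := by linarith
  have hloc : ∀ w ∈ Set.Icc (-ε) ε,
      ((0 < T w ∧ 0 < deriv T w) ∧ AnalyticAt ℝ T w) ∧ w ^ 2 / 2 = f (T w) - f s := by
    intro w hw
    refine hball ?_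
    rw [Real.dist_eq, sub_zero]
    exact (abs_le.2 hw).trans_lt hε.2
  have hTder : ∀ w ∈ Set.Icc (-ε) ε, HasDerivAt T (deriv T w) w := fun w hw =>
    (hloc w hw).1.2.differentiableAt.hasDerivAt
  have hdTcont : ContinuousOn (deriv T) (Set.Icc (-ε) ε) := fun w hw =>
    (hloc w hw).1.2.deriv.continuousAt.continuousWithinAt
  obtain ⟨C, hC⟩ := hεC hdTcont
  have hTmono : StrictMonoOn T (Set.Icc (-ε) ε) :=
    strictMonoOn_of_deriv_pos (convex_Icc _ _)
      (fun w hw => (hTder w hw).continuousAt.continuousWithinAt)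
      fun w hw => (hloc w (interior_subset hw)).1.1.2
  have hmem1 : -ε ∈ Set.Icc (-ε) ε := ⟨le_rfl, hle⟩
  have hmem2 : ε ∈ Set.Icc (-ε) ε := ⟨hle, le_rfl⟩
  have hmem0 : (0 : ℝ) ∈ Set.Icc (-ε) ε := ⟨by linarith, hε0.le⟩
  have hl : T (-ε) < s := by
    have := hTmono hmem1 hmem0 (by linarith)
    rwa [hT0] at this
  have hr : s < T ε := by
    have := hTmono hmem0 hmem2 hε0
    rwa [hT0] at this
  have hl0 : 0 < T (-ε) := (hloc _ hmem1).1.1.1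
  have hfl : f (T (-ε)) - f s = ε ^ 2 / 2 := by rw [← (hloc _ hmem1).2, neg_sq]
  have hfr : f (T ε) - f s = ε ^ 2 / 2 := (hloc _ hmem2).2.symm
  have hsub : Set.Ioc (T (-ε)) (T ε) ⊆ Set.Ioi 0 := fun t ht => hl0.trans ht.1
  -- lower bounds for the phase
  have hmin : ∀ t ∈ Set.Ioi (0 : ℝ), 0 ≤ f t - f s := by
    intro t ht
    rw [sub_nonneg]
    rcases le_total t s with h | h
    · exact hanti.antitoneOn ⟨ht, h⟩ ⟨hs, le_rfl⟩ h
    · exact hmono.monotoneOn Set.self_mem_Ici h h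
  have hout : ∀ t ∈ Set.Ioi (0 : ℝ) \ Set.Ioc (T (-ε)) (T ε), ε ^ 2 / 2 ≤ f t - f s := by
    rintro t ⟨ht, ht'⟩
    rcases le_or_gt t (T (-ε)) with h | h
    · rw [← hfl]
      exact sub_le_sub_right (hanti.antitoneOn ⟨ht, h.trans hl.le⟩ ⟨hl0, hl.le⟩ h) _
    · have h2 : T ε < t := by
        by_contra h3
        exact ht' ⟨h, not_lt.1 h3⟩
      rw [← hfr]
      exact sub_le_sub_right (hmono.monotoneOn hr.le (hr.le.trans h2.le) h2.le) _
  set M := ∫ t in Set.Ioi (0 : ℝ), Real.exp (-(f t - f s)) with hM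
  have hint' : IntegrableOn (fun t => Real.exp (-(f t - f s))) (Set.Ioi 0) := by
    refine (hint.const_mul (Real.exp (f s))).congr (Eventually.of_forall fun t => ?_)
    simp only
    rw [← Real.exp_add]
    congr 1
    ring
  have hM0 : 0 ≤ M := integral_nonneg fun t => (Real.exp_pos _).le
  -- the exponentially small part
  have hexp : ∃ R, ∀ y : ℝ, R ≤ y → Real.exp (-(c * (ε ^ 2 / 2)) * y) ≤
      y ^ (-((N : ℝ) + 1 / 2)) := by
    have h := (isLittleO_exp_neg_mul_rpow_atTop (a := c * (ε ^ 2 / 2)) (by positivity)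
      (-((N : ℝ) + 1 / 2))).bound one_pos
    obtain ⟨R, hR⟩ := eventually_atTop.1 (h.and (eventually_ge_atTop 0))
    refine ⟨R, fun y hy => ?_⟩
    obtain ⟨h1, h2⟩ := hR y hy
    rwa [one_mul, Real.norm_of_nonneg (Real.exp_pos _).le,
      Real.norm_of_nonneg (Real.rpow_nonneg h2 _)] at h1
  obtain ⟨R, hR⟩ := hexp
  -- The bounds `1` and `1 / c` force `|X| ≥ 1` and `Re X ≥ 1`. Away from the saddle one factor `exp
  -- (-(f t - f s))` is kept for integrability, with integral at most `M`; the remaining `Re X - 1`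
  -- gives the exponential decay and costs the factor `exp (ε ^ 2 / 2)`.
  refine ⟨C + Real.exp (ε ^ 2 / 2) * M, max R (max 1 (1 / c)), fun X hRX hcX => ?_⟩
  have hX1 : 1 ≤ ‖X‖ := ((le_max_left _ _).trans (le_max_right _ _)).trans hRX
  have hX0 : 0 < ‖X‖ := one_pos.trans_le hX1
  have hXre : 1 ≤ X.re := by
    refine le_trans ?_ hcX
    have : 1 / c ≤ ‖X‖ := ((le_max_right _ _).trans (le_max_right _ _)).trans hRX
    rwa [div_le_iff₀ hc, mul_comm] at this
  set F : ℝ → ℂ := fun t => Complex.exp (-X * ((f t - f s : ℝ) : ℂ)) with hF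
  have hFnorm : ∀ t, ‖F t‖ = Real.exp (-X.re * (f t - f s)) := fun t => by
    simp only [hF]
    rw [Complex.norm_exp, Complex.re_mul_ofReal, Complex.neg_re]
  have hFcont : ContinuousOn F (Set.Ioi 0) := by
    refine Complex.continuous_exp.comp_continuousOn (continuousOn_const.mul
      (Complex.continuous_ofReal.comp_continuousOn (hcont.sub continuousOn_const)))
  have hFint : IntegrableOn F (Set.Ioi 0) := by
    refine Integrable.mono' hint' (hFcont.aestronglyMeasurable measurableSet_Ioi) ?_
    refine (ae_restrict_iff' measurableSet_Ioi).2 (Eventually.of_forall fun t ht => ?_)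
    rw [hFnorm, Real.exp_le_exp]
    have := hmin t ht
    nlinarith
  have hmid : ∫ t in Set.Ioc (T (-ε)) (T ε), F t =
      ∫ w in (-ε)..ε, ((deriv T w : ℝ) : ℂ) * Complex.exp (-(X / 2) * (w : ℂ) ^ 2) := by
    rw [← intervalIntegral.integral_of_le (hl.trans hr).le]
    have himage : T '' Set.uIcc (-ε) ε ⊆ Set.Ioi 0 := by
      rw [Set.uIcc_of_le hle]
      rintro _ ⟨w, hw, rfl⟩
      exact (hloc w hw).1.1.1
    rw [← intervalIntegral.integral_deriv_smul_comp' (f := T) (f' := deriv T)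
      (by rwa [Set.uIcc_of_le hle]) (by rwa [Set.uIcc_of_le hle]) (hFcont.mono himage)]
    refine intervalIntegral.integral_congr fun w hw => ?_
    rw [Set.uIcc_of_le hle] at hw
    simp only [Function.comp_apply, hF, Complex.real_smul]
    rw [← (hloc w hw).2]
    congr 2
    push_cast
    ring
  have hrest : ‖∫ t in Set.Ioi (0 : ℝ) \ Set.Ioc (T (-ε)) (T ε), F t‖ ≤
      Real.exp (ε ^ 2 / 2) * M * ‖X‖ ^ (-((N : ℝ) + 1 / 2)) := by
    have hdom : IntegrableOn (fun t => Real.exp (-((X.re - 1) * (ε ^ 2 / 2))) *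
        Real.exp (-(f t - f s))) (Set.Ioi 0) := hint'.const_mul _
    have h1 : ‖∫ t in Set.Ioi (0 : ℝ) \ Set.Ioc (T (-ε)) (T ε), F t‖ ≤
        ∫ t in Set.Ioi (0 : ℝ) \ Set.Ioc (T (-ε)) (T ε),
          Real.exp (-((X.re - 1) * (ε ^ 2 / 2))) * Real.exp (-(f t - f s)) := by
      refine norm_integral_le_of_norm_le (hdom.mono_set Set.sdiff_subset) ?_
      refine (ae_restrict_iff' (measurableSet_Ioi.diff measurableSet_Ioc)).2
        (Eventually.of_forall fun t ht => ?_)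
      rw [hFnorm, ← Real.exp_add, Real.exp_le_exp]
      have := hout t ht
      nlinarith
    have h2 : ∫ t in Set.Ioi (0 : ℝ) \ Set.Ioc (T (-ε)) (T ε),
          Real.exp (-((X.re - 1) * (ε ^ 2 / 2))) * Real.exp (-(f t - f s)) ≤
        Real.exp (-((X.re - 1) * (ε ^ 2 / 2))) * M := by
      rw [hM, ← integral_const_mul]
      exact setIntegral_mono_set hdom (Eventually.of_forall fun t => by positivity)
        Set.sdiff_subset.eventuallyLE
    have h3 : Real.exp (-((X.re - 1) * (ε ^ 2 / 2))) ≤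
        Real.exp (ε ^ 2 / 2) * ‖X‖ ^ (-((N : ℝ) + 1 / 2)) := by
      refine le_trans ?_ (mul_le_mul_of_nonneg_left (hR ‖X‖ ((le_max_left _ _).trans hRX))
        (Real.exp_pos _).le)
      rw [← Real.exp_add, Real.exp_le_exp]
      have : 0 ≤ ε ^ 2 / 2 := by positivity
      nlinarith
    refine h1.trans (h2.trans ((mul_le_mul_of_nonneg_right h3 hM0).trans_eq ?_))
    ring
  have hsplit : ∫ t in Set.Ioi (0 : ℝ), F t = (∫ t in Set.Ioc (T (-ε)) (T ε), F t) +
      ∫ t in Set.Ioi (0 : ℝ) \ Set.Ioc (T (-ε)) (T ε), F t := by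
    rw [setIntegral_sdiff measurableSet_Ioc hFint hsub]
    ring
  rw [hsplit, hmid, add_sub_right_comm, add_mul]
  exact (norm_add_le _ _).trans (add_le_add (hC X hX0 hcX) hrest)

/-! ### Krätzel's integral: convergence, holomorphy and change of ray -/

noncomputable section

/-- The integrand `t ^ (ν - 1) * exp (-A t ^ p - B / t)`. -/
def twoTermIntegrand (p : ℝ) (ν A B : ℂ) (t : ℝ) : ℂ :=
  (t : ℂ) ^ (ν - 1) * Complex.exp (-(A * ((t ^ p : ℝ) : ℂ)) - B / (t : ℂ))

theorem kratzelIntegrand_eq (p : ℝ) (ν x : ℂ) :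
    kratzelIntegrand p ν x = twoTermIntegrand p ν 1 x := by
  funext t
  rw [kratzelIntegrand, twoTermIntegrand, one_mul]

/-- Near the origin `exp (-r / t) ≤ n! (t / r) ^ n` beats any negative power of `t`; choosing `c + n
> -1` leaves a convergent integral with weight `exp (-b t ^ p)`. -/
theorem integrableOn_rpow_mul_exp_neg_sub_div {p b r : ℝ} (hp : 0 < p) (hb : 0 < b) (hr : 0 < r)
    (c : ℝ) : IntegrableOn (fun t : ℝ => t ^ c * Real.exp (-(b * t ^ p) - r / t)) (Set.Ioi 0) := by
  obtain ⟨n, hn⟩ := exists_nat_gt (-1 - c)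
  have h := (integrableOn_rpow_mul_exp_neg_mul_rpow (p := p) (s := c + n) (by linarith) hp
    hb).const_mul ((n ! : ℝ) / r ^ n)
  refine Integrable.mono' h (ContinuousOn.aestronglyMeasurable ?_ measurableSet_Ioi) ?_
  · intro t ht
    have ht0 : t ≠ 0 := (Set.mem_Ioi.1 ht).ne'
    exact ((Real.continuousAt_rpow_const t c (Or.inl ht0)).mul (Real.continuous_exp.continuousAt.comp
      (((continuousAt_const.mul (Real.continuousAt_rpow_const t p (Or.inl ht0))).neg).sub
        (continuousAt_const.div continuousAt_id ht0)))).continuousWithinAt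
  · refine (ae_restrict_iff' measurableSet_Ioi).2 (Eventually.of_forall fun t ht => ?_)
    have ht0 : 0 < t := ht
    rw [Real.norm_of_nonneg (by positivity), Real.rpow_add ht0, Real.rpow_natCast, sub_eq_add_neg,
      Real.exp_add, ← neg_mul]
    have h1 : Real.exp (-(r / t)) ≤ (n ! : ℝ) / r ^ n * t ^ n := by
      have h2 := Real.pow_div_factorial_le_exp (r / t) (by positivity) n
      rw [Real.exp_neg, inv_le_comm₀ (Real.exp_pos _) (by positivity)]
      refine le_trans (le_of_eq ?_) h2
      rw [div_pow]
      field_simp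
    calc t ^ c * (Real.exp (-b * t ^ p) * Real.exp (-(r / t)))
        ≤ t ^ c * (Real.exp (-b * t ^ p) * ((n ! : ℝ) / r ^ n * t ^ n)) := by gcongr
      _ = _ := by ring

theorem norm_twoTermIntegrand (p : ℝ) (ν A B : ℂ) {t : ℝ} (ht : 0 < t) :
    ‖twoTermIntegrand p ν A B t‖ = t ^ (ν.re - 1) * Real.exp (-(A.re * t ^ p) - B.re / t) := by
  rw [twoTermIntegrand, norm_mul, Complex.norm_cpow_eq_rpow_re_of_pos ht, Complex.norm_exp]
  simp [Complex.div_ofReal_re]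

theorem continuousOn_twoTermIntegrand (p : ℝ) (ν A B : ℂ) :
    ContinuousOn (twoTermIntegrand p ν A B) (Set.Ioi 0) := by
  intro t ht
  have ht0 : t ≠ 0 := (Set.mem_Ioi.1 ht).ne'
  have h1 : ContinuousAt (fun t : ℝ => (t : ℂ) ^ (ν - 1)) t :=
    Complex.continuousAt_ofReal_cpow_const t _ (Or.inr ht0)
  have h2 : ContinuousAt (fun t : ℝ => ((t ^ p : ℝ) : ℂ)) t :=
    Complex.continuous_ofReal.continuousAt.comp (Real.continuousAt_rpow_const t p (Or.inl ht0))
  have h3 : ContinuousAt (fun t : ℝ => B / (t : ℂ)) t :=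
    continuousAt_const.div Complex.continuous_ofReal.continuousAt (by exact_mod_cast ht0)
  exact (h1.mul (((continuousAt_const.mul h2).neg.sub h3).cexp)).continuousWithinAt

theorem integrableOn_twoTermIntegrand {p : ℝ} (hp : 0 < p) (ν : ℂ) {A B : ℂ} (hA : 0 < A.re)
    (hB : 0 < B.re) : IntegrableOn (twoTermIntegrand p ν A B) (Set.Ioi 0) := by
  refine Integrable.mono' (integrableOn_rpow_mul_exp_neg_sub_div hp hA hB (ν.re - 1))
    ((continuousOn_twoTermIntegrand p ν A B).aestronglyMeasurable measurableSet_Ioi) ?_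
  exact (ae_restrict_iff' measurableSet_Ioi).2
    (Eventually.of_forall fun t ht => (norm_twoTermIntegrand p ν A B ht).le)

/-- The family `(α + β z, z)` covers both `(1, z)`, for the original integral, and `(z / p, z)`, for
the rescaled one. Differentiation under the integral is dominated on `Re z > Re z₀ / 2`, since the
factors `t ^ p` and `1 / t` it produces only shift the power of `t`. -/
theorem differentiableAt_integral_twoTermIntegrand {p : ℝ} (hp : 0 < p) (ν : ℂ) {α β : ℝ}
    (hα : 0 ≤ α) (hβ : 0 ≤ β) (hαβ : 0 < α + β) {z₀ : ℂ} (hz : 0 < z₀.re) :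
    DifferentiableAt ℂ (fun z : ℂ => ∫ t in Set.Ioi (0 : ℝ),
      twoTermIntegrand p ν (α + β * z) z t) z₀ := by
  set r := z₀.re / 2 with hr
  have hr0 : 0 < r := half_pos hz
  have hb : ∀ {y : ℝ}, 0 < y → 0 < α + β * y := fun {y} hy => by
    rcases hα.eq_or_lt with h | h
    · rw [← h, zero_add] at hαβ ⊢
      positivity
    · positivity
  have hre : ∀ z : ℂ, ((α : ℂ) + β * z).re = α + β * z.re := fun z => by simp
  set F' : ℂ → ℝ → ℂ := fun z t =>
    (-(((β * t ^ p : ℝ) : ℂ)) - 1 / (t : ℂ)) * twoTermIntegrand p ν (α + β * z) z t with hF'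
  set bound : ℝ → ℝ := fun t =>
    β * (t ^ (ν.re - 1 + p) * Real.exp (-((α + β * r) * t ^ p) - r / t)) +
      t ^ (ν.re - 1 - 1) * Real.exp (-((α + β * r) * t ^ p) - r / t) with hbound
  refine (hasDerivAt_integral_of_dominated_loc_of_deriv_le (F' := F') (bound := bound)
    (s := {z : ℂ | r < z.re}) ((isOpen_lt continuous_const Complex.continuous_re).mem_nhds
      (half_lt_self hz)) ?_ ?_ ?_ ?_ ?_ ?_).2.differentiableAt
  · exact Eventually.of_forall fun z =>
      (continuousOn_twoTermIntegrand p ν _ z).aestronglyMeasurable measurableSet_Ioi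
  · exact integrableOn_twoTermIntegrand hp ν (by rw [hre]; exact hb hz) hz
  · refine ContinuousOn.aestronglyMeasurable (ContinuousOn.mul ?_
      (continuousOn_twoTermIntegrand p ν _ z₀)) measurableSet_Ioi
    intro t ht
    have ht0 : t ≠ 0 := (Set.mem_Ioi.1 ht).ne'
    refine ContinuousAt.continuousWithinAt (ContinuousAt.sub (ContinuousAt.neg ?_) ?_)
    · exact Complex.continuous_ofReal.continuousAt.comp
        (continuousAt_const.mul (Real.continuousAt_rpow_const t p (Or.inl ht0)))
    · exact continuousAt_const.div Complex.continuous_ofReal.continuousAt (by exact_mod_cast ht0)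
  · refine (ae_restrict_iff' measurableSet_Ioi).2 (Eventually.of_forall fun t ht z hz' => ?_)
    have ht0 : 0 < t := ht
    have hz' : r < z.re := hz'
    have h1 : ‖-(((β * t ^ p : ℝ) : ℂ)) - 1 / (t : ℂ)‖ = β * t ^ p + 1 / t := by
      rw [← norm_neg, neg_sub, sub_neg_eq_add, add_comm]
      have : ((β * t ^ p : ℝ) : ℂ) + 1 / (t : ℂ) = ((β * t ^ p + 1 / t : ℝ) : ℂ) := by push_cast; rfl
      rw [this, Complex.norm_real, Real.norm_of_nonneg (by positivity)]
    simp only [hF', hbound]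
    rw [norm_mul, h1, norm_twoTermIntegrand _ _ _ _ ht0, hre, Real.rpow_add ht0,
      Real.rpow_sub_one ht0.ne' (ν.re - 1)]
    have h2 : Real.exp (-((α + β * z.re) * t ^ p) - z.re / t) ≤
        Real.exp (-((α + β * r) * t ^ p) - r / t) := by
      rw [Real.exp_le_exp]
      gcongr
    calc (β * t ^ p + 1 / t) * (t ^ (ν.re - 1) * Real.exp (-((α + β * z.re) * t ^ p) - z.re / t))
        ≤ (β * t ^ p + 1 / t) * (t ^ (ν.re - 1) * Real.exp (-((α + β * r) * t ^ p) - r / t)) := by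
          gcongr
      _ = _ := by ring
  · exact ((integrableOn_rpow_mul_exp_neg_sub_div hp (hb hr0) hr0 _).const_mul β).add
      (integrableOn_rpow_mul_exp_neg_sub_div hp (hb hr0) hr0 _)
  · refine Eventually.of_forall fun t z _ => ?_
    have h1 : HasDerivAt (fun z : ℂ => -((α + β * z) * ((t ^ p : ℝ) : ℂ)) - z / (t : ℂ))
        (-((β * 1) * ((t ^ p : ℝ) : ℂ)) - 1 / (t : ℂ)) z :=
      ((((hasDerivAt_id z).const_mul (β : ℂ)).const_add (α : ℂ)).mul_const _).fun_neg.fun_sub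
        ((hasDerivAt_id z).div_const _)
    refine (h1.cexp.const_mul ((t : ℂ) ^ (ν - 1))).congr_deriv ?_
    simp only [hF', twoTermIntegrand]
    push_cast
    ring

theorem bigX_re (p : ℝ) (x : ℂ) : (bigX p x).re =
    p ^ (1 / (p + 1)) * (‖x‖ ^ (p / (p + 1)) * Real.cos (x.arg * (p / (p + 1)))) := by
  rw [bigX, Complex.re_ofReal_mul, Complex.cpow_ofReal_re]

theorem norm_bigX {p : ℝ} (hp : 0 < p) (x : ℂ) :
    ‖bigX p x‖ = p ^ (1 / (p + 1)) * ‖x‖ ^ (p / (p + 1)) := by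
  rw [bigX, norm_mul, Complex.norm_real, Complex.norm_cpow_real,
    Real.norm_of_nonneg (by positivity)]

/-- The exponent `p / (p + 1) < 1` narrows the sector to half-angle below `π / 2`. This cosine is
the constant in `Re X ≥ c |X|`. -/
theorem cos_sector_pos {p : ℝ} (hp : 0 < p) : 0 < Real.cos (Real.pi / 2 * (p / (p + 1))) := by
  have h1 : 0 < p / (p + 1) := by positivity
  have h2 : p / (p + 1) < 1 := by rw [div_lt_one (by linarith)]; linarith
  have := Real.pi_pos
  exact Real.cos_pos_of_mem_Ioo ⟨by nlinarith, by nlinarith⟩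

theorem cos_mul_norm_bigX_le_re {p : ℝ} (hp : 0 < p) {x : ℂ} (hx : |x.arg| < Real.pi / 2) :
    Real.cos (Real.pi / 2 * (p / (p + 1))) * ‖bigX p x‖ ≤ (bigX p x).re := by
  rw [norm_bigX hp, bigX_re]
  have h1 : 0 < p / (p + 1) := by positivity
  have h2 : p / (p + 1) < 1 := by rw [div_lt_one (by linarith)]; linarith
  have h3 : Real.cos (Real.pi / 2 * (p / (p + 1))) ≤ Real.cos (x.arg * (p / (p + 1))) := by
    rw [← Real.cos_abs (x.arg * _), abs_mul, abs_of_pos h1]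
    have := Real.pi_pos
    exact Real.cos_le_cos_of_nonneg_of_le_pi (by positivity) (by nlinarith) (by gcongr)
  rw [mul_comm, mul_assoc]
  gcongr

theorem bigX_re_pos {p : ℝ} (hp : 0 < p) {x : ℂ} (hx : 0 < x.re) : 0 < (bigX p x).re := by
  have hx0 : x ≠ 0 := by
    rintro rfl
    simp at hx
  refine lt_of_lt_of_le ?_ (cos_mul_norm_bigX_le_re hp
    (Complex.abs_arg_lt_pi_div_two_iff.2 (Or.inl hx)))
  rw [norm_bigX hp]
  have := norm_pos_iff.2 hx0
  have := cos_sector_pos hp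
  positivity

theorem integral_twoTermIntegrand_scaling {p : ℝ} (hp : 0 < p) (ν : ℂ) {x : ℝ} (hx : 0 < x) :
    ∫ t in Set.Ioi (0 : ℝ), twoTermIntegrand p ν 1 x t =
      ((x : ℂ) / p) ^ (ν / (p + 1)) *
        ∫ t in Set.Ioi (0 : ℝ), twoTermIntegrand p ν (bigX p x / p) (bigX p x) t := by
  have hp1 : p + 1 ≠ 0 := by positivity
  -- Chosen so that `t = c u` gives the coefficients `c ^ p = X / p` and `x / c = X`.
  set c : ℝ := (x / p) ^ (1 / (p + 1)) with hc
  have hxp : 0 < x / p := by positivity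
  have hc0 : 0 < c := Real.rpow_pos_of_pos hxp _
  have hcc : c ^ p * c = x / p := by
    rw [← Real.rpow_add_one hc0.ne', hc, ← Real.rpow_mul hxp.le, one_div_mul_cancel hp1,
      Real.rpow_one]
  have hX : bigX p x = ((x / c : ℝ) : ℂ) := by
    rw [bigX, ← Complex.ofReal_cpow hx.le, ← Complex.ofReal_mul]
    congr 1
    rw [hc, Real.div_rpow hx.le hp.le, show p / (p + 1) = 1 - 1 / (p + 1) by field_simp; ring,
      Real.rpow_sub hx, Real.rpow_one]
    have := Real.rpow_pos_of_pos hx (1 / (p + 1))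
    field_simp
  have hcν : (c : ℂ) * (c : ℂ) ^ (ν - 1) = ((x : ℂ) / p) ^ (ν / (p + 1)) := by
    have hc0' : (c : ℂ) ≠ 0 := by exact_mod_cast hc0.ne'
    have hxp' : ((x / p : ℝ) : ℂ) ≠ 0 := by exact_mod_cast hxp.ne'
    rw [Complex.cpow_sub _ _ hc0', Complex.cpow_one, mul_div_cancel₀ _ hc0', ← Complex.ofReal_div,
      Complex.cpow_def_of_ne_zero hc0', Complex.cpow_def_of_ne_zero hxp', ← Complex.ofReal_log hc0.le,
      ← Complex.ofReal_log hxp.le, hc, Real.log_rpow hxp]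
    congr 1
    push_cast
    ring
  have hg : ∀ t ∈ Set.Ioi (0 : ℝ), twoTermIntegrand p ν 1 x (c * t) =
      (c : ℂ) ^ (ν - 1) * twoTermIntegrand p ν (bigX p x / p) (bigX p x) t := by
    intro t ht
    have ht0 : 0 < t := ht
    rw [twoTermIntegrand, twoTermIntegrand, hX, Complex.ofReal_mul,
      Complex.mul_cpow_ofReal_nonneg hc0.le ht0.le, mul_assoc, Real.mul_rpow hc0.le ht0.le]
    congr 3
    have h1 : c ^ p = x / c / p := by
      field_simp
      field_simp at hcc
      linarith
    rw [h1]
    have hc0' : (c : ℂ) ≠ 0 := by exact_mod_cast hc0.ne'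
    have ht0' : (t : ℂ) ≠ 0 := by exact_mod_cast ht0.ne'
    push_cast
    field_simp
  have h := integral_comp_mul_left_Ioi (twoTermIntegrand p ν 1 x) 0 hc0
  rw [setIntegral_congr_fun measurableSet_Ioi hg, integral_const_mul, mul_zero, Complex.real_smul,
    Complex.ofReal_inv] at h
  have hc0' : (c : ℂ) ≠ 0 := by exact_mod_cast hc0.ne'
  rw [← hcν, mul_assoc, h, mul_inv_cancel_left₀ hc0']

/-- Krätzel's integral along the ray on which its exponent is real up to the factor `bigX p x`. -/
theorem integral_twoTermIntegrand_rotation {p : ℝ} (hp : 0 < p) (ν : ℂ) {x : ℂ} (hx : 0 < x.re) :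
    ∫ t in Set.Ioi (0 : ℝ), twoTermIntegrand p ν 1 x t =
      (x / p) ^ (ν / (p + 1)) *
        ∫ t in Set.Ioi (0 : ℝ), twoTermIntegrand p ν (bigX p x / p) (bigX p x) t := by
  set U : Set ℂ := {z | 0 < z.re} with hU
  have hUo : IsOpen U := isOpen_lt continuous_const Complex.continuous_re
  have hslit : ∀ z ∈ U, z ∈ Complex.slitPlane := fun z hz => Or.inl hz
  have hpc : (p : ℂ) ≠ 0 := by exact_mod_cast hp.ne'
  have hL : AnalyticOnNhd ℂ (fun z => ∫ t in Set.Ioi (0 : ℝ), twoTermIntegrand p ν 1 z t) U := by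
    refine DifferentiableOn.analyticOnNhd (fun z hz => ?_) hUo
    have := differentiableAt_integral_twoTermIntegrand hp ν zero_le_one le_rfl
      (by norm_num : (0 : ℝ) < 1 + 0) (z₀ := z) hz
    simp only [Complex.ofReal_one, Complex.ofReal_zero, zero_mul, add_zero] at this
    exact this.differentiableWithinAt
  have hR : AnalyticOnNhd ℂ (fun z : ℂ => (z / p) ^ (ν / (p + 1)) *
        ∫ t in Set.Ioi (0 : ℝ), twoTermIntegrand p ν (bigX p z / p) (bigX p z) t) U := by
    refine DifferentiableOn.analyticOnNhd (fun z hz => ?_) hUo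
    have h1 : DifferentiableAt ℂ (fun z : ℂ => (z / p) ^ (ν / (p + 1))) z := by
      refine (differentiableAt_id.div_const _).cpow (differentiableAt_const _) (Or.inl ?_)
      have : 0 < (z / (p : ℂ)).re := by
        rw [Complex.div_ofReal_re]
        exact div_pos hz hp
      exact this
    have h2 : DifferentiableAt ℂ (bigX p) z := by
      unfold bigX
      exact (differentiableAt_id.cpow (differentiableAt_const _) (hslit z hz)).const_mul _
    have h3 := differentiableAt_integral_twoTermIntegrand hp ν (α := 0) (β := 1 / p) le_rfl
      (by positivity) (by positivity) (bigX_re_pos hp hz)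
    have h4 : (fun w : ℂ => ∫ t in Set.Ioi (0 : ℝ),
        twoTermIntegrand p ν ((0 : ℝ) + (1 / p : ℝ) * w) w t) =
        fun w : ℂ => ∫ t in Set.Ioi (0 : ℝ), twoTermIntegrand p ν (w / p) w t := by
      funext w
      have e : ((0 : ℝ) : ℂ) + ((1 / p : ℝ) : ℂ) * w = w / p := by
        push_cast
        ring
      rw [e]
    rw [h4] at h3
    exact (h1.mul (h3.comp z h2)).differentiableWithinAt
  -- Identity theorem on the half-plane: the two sides agree at the positive reals, which accumulate
  -- at `1`. Here `ν` is a constant; it may be made to depend on `x` afterwards, as the identity is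
  -- pointwise.
  refine hL.eqOn_of_preconnected_of_frequently_eq hR
    (convex_halfSpace_re_gt 0).isPreconnected (z₀ := 1) (by simp [hU]) ?_ hx
  have htend : Tendsto (fun y : ℝ => (y : ℂ)) (𝓝[≠] 1) (𝓝[≠] 1) := by
    refine tendsto_nhdsWithin_iff.2 ⟨?_, ?_⟩
    · exact ((Complex.continuous_ofReal.tendsto 1).mono_left nhdsWithin_le_nhds)
    · filter_upwards [self_mem_nhdsWithin] with y hy
      simpa using hy
  refine htend.frequently (Eventually.frequently ?_)
  filter_upwards [nhdsWithin_le_nhds (lt_mem_nhds (zero_lt_one (α := ℝ)))] with y hy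
  exact integral_twoTermIntegrand_scaling hp ν hy

end

/-! ### Reduction to the Laplace integral and conclusion -/

/-- A positive factor leaves the argument unchanged, so principal powers stay multiplicative. -/
theorem cpow_ofReal_pos_mul {r : ℝ} (hr : 0 < r) {z : ℂ} (hz : z ≠ 0) (y : ℂ) :
    ((r : ℂ) * z) ^ y = (r : ℂ) ^ y * z ^ y := by
  have hr' : (r : ℂ) ≠ 0 := by exact_mod_cast hr.ne'
  rw [Complex.cpow_def_of_ne_zero (mul_ne_zero hr' hz), Complex.cpow_def_of_ne_zero hr',
    Complex.cpow_def_of_ne_zero hz, Complex.log_ofReal_mul hr hz, Complex.ofReal_log hr.le, add_mul,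
    Complex.exp_add]

theorem two_pi_div_cpow_half {X : ℂ} (hX : X ≠ 0) {c : ℝ} (hc : 0 < c) :
    (2 * (Real.pi : ℂ) / (X * c)) ^ (1 / 2 : ℂ) =
      ((1 / Real.sqrt c : ℝ) : ℂ) * (2 * Real.pi / X) ^ (1 / 2 : ℂ) := by
  have hpi : (Real.pi : ℂ) ≠ 0 := by exact_mod_cast Real.pi_ne_zero
  have hz : 2 * (Real.pi : ℂ) / X ≠ 0 := by simp [hpi, hX]
  have e : 2 * (Real.pi : ℂ) / (X * c) = ((1 / c : ℝ) : ℂ) * (2 * Real.pi / X) := by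
    push_cast
    field_simp
  rw [e, cpow_ofReal_pos_mul (by positivity) hz]
  congr 1
  have : (1 / 2 : ℂ) = ((1 / 2 : ℝ) : ℂ) := by push_cast; rfl
  rw [this, ← Complex.ofReal_cpow (by positivity), ← Real.sqrt_eq_rpow, Real.sqrt_div zero_le_one,
    Real.sqrt_one]

/-- The order `ν = 1 + a X` makes `t ^ (ν - 1) = exp (a X log t)`, which supplies the logarithm in
the phase. -/
theorem twoTermIntegrand_eq_cexp_phase (p a : ℝ) (X : ℂ) {t : ℝ} (ht : 0 < t) :
    twoTermIntegrand p (1 + a * X) (X / p) X t = Complex.exp (-X * ((phase p a t : ℝ) : ℂ)) := by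
  have ht' : (t : ℂ) ≠ 0 := by exact_mod_cast ht.ne'
  rw [twoTermIntegrand, Complex.cpow_def_of_ne_zero ht', ← Complex.exp_add, phase,
    ← Complex.ofReal_log ht.le]
  congr 1
  push_cast
  ring

theorem integrableOn_exp_neg_phase {p : ℝ} (hp : 0 < p) (a : ℝ) :
    IntegrableOn (fun t => Real.exp (-phase p a t)) (Set.Ioi 0) := by
  refine (integrableOn_rpow_mul_exp_neg_sub_div hp (b := 1 / p) (r := 1) (by positivity) one_pos
    a).congr_fun (fun t ht => ?_) measurableSet_Ioi
  have ht0 : 0 < t := ht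
  simp only [phase]
  rw [Real.rpow_def_of_pos ht0 a, ← Real.exp_add]
  congr 1
  ring

/-- The factor in front of the expansion, in terms of the value of the phase at the saddle. -/
theorem expansionPrefactor_eq {p a s : ℝ} (hp : 0 < p) (hs : 0 < s) (hsa : s ^ p - 1 / s = a)
    (x : ℂ) : expansionPrefactor p a s x =
      (2 * (Real.pi : ℂ) / (bigX p x * ((iteratedDeriv 2 (phase p a) s : ℝ) : ℂ))) ^ (1 / 2 : ℂ) *
        (x / (p : ℂ)) ^ (largeNu p a x / ((p : ℂ) + 1)) *
        Complex.exp (-bigX p x * ((phase p a s : ℝ) : ℂ)) := by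
  have hs' : (s : ℂ) ≠ 0 := by exact_mod_cast hs.ne'
  have hp' : (p : ℂ) ≠ 0 := by exact_mod_cast hp.ne'
  -- By the saddle equation `s ^ p = 1 / s + a`, `φ(s) = κ / s + a / p - a log s`.
  rw [expansionPrefactor, Complex.cpow_def_of_ne_zero hs', mul_assoc _ (Complex.exp _),
    ← Complex.exp_add, phase, ← Complex.ofReal_log hs.le,
    show s ^ p = 1 / s + a by rw [← hsa]; ring]
  congr 2
  push_cast
  field_simp
  ring

theorem kratzelF_eq {p : ℝ} (hp : 0 < p) (a s : ℝ) {x : ℂ} (hx : 0 < x.re) :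
    kratzelF p (largeNu p a x) x = (x / (p : ℂ)) ^ (largeNu p a x / ((p : ℂ) + 1)) *
      (Complex.exp (-bigX p x * ((phase p a s : ℝ) : ℂ)) * ∫ t in Set.Ioi (0 : ℝ),
        Complex.exp (-bigX p x * ((phase p a t - phase p a s : ℝ) : ℂ))) := by
  have h : ∀ t ∈ Set.Ioi (0 : ℝ), twoTermIntegrand p (largeNu p a x) (bigX p x / p) (bigX p x) t =
      Complex.exp (-bigX p x * ((phase p a s : ℝ) : ℂ)) *
        Complex.exp (-bigX p x * ((phase p a t - phase p a s : ℝ) : ℂ)) := fun t ht => by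
    rw [largeNu, twoTermIntegrand_eq_cexp_phase p a _ ht, ← Complex.exp_add]
    congr 1
    push_cast
    ring
  rw [kratzelF, kratzelIntegrand_eq, integral_twoTermIntegrand_rotation hp _ hx,
    setIntegral_congr_fun (measurableSet_Ioi (a := (0 : ℝ))) h, integral_const_mul]

theorem tendsto_norm_bigX {p : ℝ} (hp : 0 < p) :
    Tendsto (fun x => ‖bigX p x‖) (Bornology.cobounded ℂ) atTop := by
  simp only [norm_bigX hp]
  exact Tendsto.const_mul_atTop (Real.rpow_pos_of_pos hp _)
    ((tendsto_rpow_atTop (y := p / (p + 1)) (by positivity)).comp tendsto_norm_cobounded_atTop)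

theorem mainTheorem2 (p a : ℝ) (hp : 0 < p) (ha : 0 < a) :
    -- the integral converges absolutely
    (∀ x : ℂ, x ≠ 0 → |x.arg| < Real.pi / 2 →
      IntegrableOn (kratzelIntegrand p (largeNu p a x) x) (Set.Ioi (0 : ℝ))) ∧
    -- the saddle `s`, which is the only positive root of its equation
    ∃ s : ℝ, 1 < s ∧ s ^ (p + 1) = 1 + a * s ∧
      (∀ τ : ℝ, 0 < τ → τ ^ (p + 1) = 1 + a * τ → τ = s) ∧
      -- the `C_k` come from inverting `w ^ 2 / 2 = φ(τ) - φ(s)`: the even part of `dτ/dw` is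
      -- `φ''(s) ^ (-1/2) * ∑ C_k w ^ (2k)`
      (∃ T : ℝ → ℝ, AnalyticAt ℝ T 0 ∧ T 0 = s ∧ 0 < deriv T 0 ∧
        (∀ᶠ w in 𝓝 (0 : ℝ), w ^ 2 / 2 = phase p a (T w) - phase p a s) ∧
        ∀ᶠ w in 𝓝 (0 : ℝ),
          HasSum (fun k : ℕ => 1 / Real.sqrt (iteratedDeriv 2 (phase p a) s) *
              (saddleCoeff (phase p a) s k * w ^ (2 * k)))
            ((deriv T w + deriv T (-w)) / 2)) ∧
      -- the first three coefficients
      saddleCoeff (phase p a) s 0 = 1 ∧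
      saddleCoeff (phase p a) s 1 =
        (5 * iteratedDeriv 3 (phase p a) s ^ 2
          - 3 * iteratedDeriv 2 (phase p a) s * iteratedDeriv 4 (phase p a) s) /
        (24 * iteratedDeriv 2 (phase p a) s ^ 3) ∧
      saddleCoeff (phase p a) s 2 =
        (385 * iteratedDeriv 3 (phase p a) s ^ 4
          - 630 * iteratedDeriv 2 (phase p a) s * iteratedDeriv 3 (phase p a) s ^ 2
              * iteratedDeriv 4 (phase p a) s
          + 105 * iteratedDeriv 2 (phase p a) s ^ 2 * iteratedDeriv 4 (phase p a) s ^ 2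
          + 168 * iteratedDeriv 2 (phase p a) s ^ 2 * iteratedDeriv 3 (phase p a) s
              * iteratedDeriv 5 (phase p a) s
          - 24 * iteratedDeriv 2 (phase p a) s ^ 3 * iteratedDeriv 6 (phase p a) s) /
        (3456 * iteratedDeriv 2 (phase p a) s ^ 6) ∧
      -- the asymptotic expansion, to every order, uniformly in the sector
      ∀ N : ℕ,
        (fun x : ℂ => kratzelF p (largeNu p a x) x - expansionPrefactor p a s x *
          ∑ k ∈ Finset.range N, (ascPochhammer ℂ k).eval (1 / 2 : ℂ) *
            ((saddleCoeff (phase p a) s k : ℝ) : ℂ) * (bigX p x / 2) ^ (-(k : ℤ)))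
        =O[sectorAtInfinity]
        (fun x : ℂ => expansionPrefactor p a s x * bigX p x ^ (-(N : ℤ))) := by
  obtain ⟨s, hs1, hsa⟩ := exists_saddle hp ha
  have hs : 0 < s := one_pos.trans hs1
  have hd2 := iteratedDeriv_two_phase_saddle_pos hp hs hsa
  obtain ⟨T, hT, hT0, hT', hTw, hTc⟩ := exists_saddle_inverse (analyticAt_phase p a hs)
    (deriv_phase_saddle hp hs hsa) hd2
  refine ⟨fun x hx0 hx => ?_, s, hs1, (rpow_add_one_eq_iff hs).2 hsa, fun τ hτ h => ?_,
    ⟨T, hT, hT0, hT', hTw, ?_⟩, saddleCoeff_zero _ _, saddleCoeff_one _ _ hd2.ne',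
    saddleCoeff_two _ _ hd2.ne', fun N => ?_⟩
  · rw [kratzelIntegrand_eq]
    refine integrableOn_twoTermIntegrand hp _ (by simp) ?_
    exact (Complex.abs_arg_lt_pi_div_two_iff.1 hx).resolve_right hx0
  · refine (strictMonoOn_rpow_sub_inv hp).injOn hτ hs ?_
    exact ((rpow_add_one_eq_iff hτ).1 h).trans hsa.symm
  · filter_upwards [hT.deriv.hasSum_even_part] with w hw
    simpa only [hTc, mul_assoc] using hw
  · obtain ⟨C, R, hCR⟩ := laplace_saddle hs
      (fun t ht => (analyticAt_phase p a ht).continuousAt.continuousWithinAt)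
      (strictAntiOn_phase hp hsa) (strictMonoOn_phase hp hs hsa) (integrableOn_exp_neg_phase hp a)
      hT hT0 hT' hTw N (cos_sector_pos hp)
    set d := iteratedDeriv 2 (phase p a) s with hd
    set K := 1 / Real.sqrt d * (2 * Real.pi) ^ (1 / 2 : ℝ) with hK
    have hK0 : 0 < K := by
      have := Real.sqrt_pos.2 hd2
      have := Real.pi_pos
      positivity
    -- The square-root factor has norm `K |X| ^ (-1/2)`, so dividing the Laplace error `C |X| ^ (-(N
    -- + 1/2))` by it leaves `(C / K) |X| ^ (-N)`. The other factors are common to both sides.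
    refine IsBigO.of_bound (C / K) ?_
    have hev : ∀ᶠ x in sectorAtInfinity, max R 1 ≤ ‖bigX p x‖ :=
      ((tendsto_norm_bigX hp).eventually_ge_atTop (max R 1)).filter_mono inf_le_left
    have hev0 : ∀ᶠ x in sectorAtInfinity, x ≠ 0 :=
      (Bornology.eventually_ne_cobounded (0 : ℂ)).filter_mono inf_le_left
    have hev1 : ∀ᶠ x in sectorAtInfinity, |x.arg| < Real.pi / 2 :=
      (eventually_principal.2 fun x hx => hx).filter_mono inf_le_right
    filter_upwards [hev, hev0, hev1] with x hxR hx0 hxarg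
    have hre : 0 < x.re := (Complex.abs_arg_lt_pi_div_two_iff.1 hxarg).resolve_right hx0
    have hb := hCR (bigX p x) ((le_max_left _ _).trans hxR) (cos_mul_norm_bigX_le_re hp hxarg)
    rw [kratzelF_eq hp a s hre, expansionPrefactor_eq hp hs hsa]
    have hX0 : 0 < ‖bigX p x‖ := one_pos.trans_le ((le_max_right _ _).trans hxR)
    set X := bigX p x
    have hX : X ≠ 0 := norm_pos_iff.1 hX0
    set D := (x / (p : ℂ)) ^ (largeNu p a x / ((p : ℂ) + 1))
    set E := Complex.exp (-X * ((phase p a s : ℝ) : ℂ))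
    set G := (2 * (Real.pi : ℂ) / (X * (d : ℂ))) ^ (1 / 2 : ℂ) with hG
    have hGX : G = ((1 / Real.sqrt d : ℝ) : ℂ) * (2 * Real.pi / X) ^ (1 / 2 : ℂ) :=
      two_pi_div_cpow_half hX hd2
    have hGn : ‖G‖ = K * ‖X‖ ^ (-(1 / 2) : ℝ) := by
      have e : (1 / 2 : ℂ) = ((1 / 2 : ℝ) : ℂ) := by push_cast; rfl
      rw [hGX, e, norm_mul, Complex.norm_cpow_real, Complex.norm_real,
        Real.norm_of_nonneg (by positivity), norm_div, norm_mul, Complex.norm_real,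
        Real.norm_of_nonneg Real.pi_pos.le, Complex.norm_ofNat,
        Real.div_rpow (by positivity) (norm_nonneg _), Real.rpow_neg (norm_nonneg _), hK]
      ring
    have hsum : ∑ k ∈ Finset.range N,
        ((PowerSeries.coeff (2 * k) (taylorSeries (deriv T)) : ℝ) : ℂ) *
          ((ascPochhammer ℂ k).eval (1 / 2 : ℂ) * (X / 2) ^ (-(k : ℤ)) *
            (2 * Real.pi / X) ^ (1 / 2 : ℂ)) =
        G * ∑ k ∈ Finset.range N, (ascPochhammer ℂ k).eval (1 / 2 : ℂ) *
          ((saddleCoeff (phase p a) s k : ℝ) : ℂ) * (X / 2) ^ (-(k : ℤ)) := by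
      rw [hGX, Finset.mul_sum]
      refine Finset.sum_congr rfl fun k _ => ?_
      rw [hTc]
      push_cast
      ring
    rw [hsum] at hb
    set I := ∫ t in Set.Ioi (0 : ℝ), Complex.exp (-X * ((phase p a t - phase p a s : ℝ) : ℂ))
    set S := ∑ k ∈ Finset.range N, (ascPochhammer ℂ k).eval (1 / 2 : ℂ) *
      ((saddleCoeff (phase p a) s k : ℝ) : ℂ) * (X / 2) ^ (-(k : ℤ))
    have e1 : D * (E * I) - G * D * E * S = D * E * (I - G * S) := by ring
    have e2 : ‖X‖ ^ (-((N : ℝ) + 1 / 2)) = ‖X‖ ^ (-(1 / 2) : ℝ) * ‖X ^ (-(N : ℤ))‖ := by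
      rw [neg_add, Real.rpow_add hX0, norm_zpow, ← Real.rpow_intCast]
      push_cast
      ring
    rw [e1, norm_mul, norm_mul (G * D * E), norm_mul (G * D), norm_mul G, hGn, norm_mul D]
    refine (mul_le_mul_of_nonneg_left hb (by positivity)).trans_eq ?_
    rw [e2]
    field_simp
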